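/- **Definitions.** Let $\mathbb D$ be a category and $\mathcal Z$ a class of objects. A morphism is *$\mathcal Z$-trivial* if it factors through an object of $\mathcal Z$. A morphism $k\colon K\to A$ is a *$\mathcal Z$-kernel* of $f\colon A\to B$ if $fk$ is $\mathcal Z$-trivial and every $l\colon Y\to A$ with $fl$ $\mathcal Z$-trivial factors uniquely through $k$; *$\mathcal Z$-cokernels* are defined dually. A sequence $A\xrightarrow{f}B\xrightarrow{g}C$ is *short $\mathcal Z$-exact* if $f$ is a $\mathcal Z$-kernel of $g$ and $g$ is a $\mathcal Z$-cokernel of $f$. In a pointed category, with $\mathcal Z$ the zero objects, one gets kernels, cokernels and short exact sequences. A *pretorsion theory* in $\mathbb D$ is a pair $(\mathcal T,\mathcal F)$ of replete full subcategories such that, with $\mathcal Z=\mathcal T\cap\mathcal F$, every morphism from an object of $\mathcal T$ to an object of $\mathcal F$ is $\mathcal Z$-trivial, and every object $A$ lies in a short $\mathcal Z$-exact sequence $T(A)\to A\to F(A)$ with $T(A)\in\mathcal T$, $F(A)\in\mathcal F$ (unique up to isomorphism, called canonical). A *torsion theory* in a pointed category is a pretorsion theory for which $\mathcal T\cap\mathcal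 F$ is the class of zero objects. A functor from a category with a pretorsion theory $(\mathcal T,\mathcal F)$ to a pointed category with a torsion theory $(\mathcal T',\mathcal F')$ is a *torsion theory functor* if it maps $\mathcal T$ into $\mathcal T'$, $\mathcal F$ into $\mathcal F'$, and canonical short $\mathcal Z$-exact sequences to short exact sequences. A *pretopos* is a Barr-exact category with finite sums that is extensive; a *$\tau$-pretopos* is a pretopos in which every relation on an object has a transitive closure (a smallest transitive relation containing it). For a pretopos $\mathbb C$, let $\mathsf{PreOrd}(\mathbb C)$ be the category of internal preorders $(A,\rho)$ ($\rho\rightarrowtail A\times A$ reflexive and transitive) and relation-preserving morphisms, with its pretorsion theory $(\mathsf{Eq}(\mathbb C),\mathsf{ParOrd}(\mathbb C))$ of internal equivalence relations and internal partial orders; here $\mathcal Z=\mathsf{Eq}(\mathbb C)\cap\mathsf{ParOrd}(\mathbb C)$ consists of the discrete preorders $(A,\Delta_A)$, and "trivial" means $\mathcal Z$-trivial. A subobject $\alpha\colon A'\rightarrowtail A$ is *complemented* if there is a subobject $\alpha^c\colon A'^c\rightarrowtail A$ with $A'\cap A'^c=0$ and $A'\cup A'^c=A$. Let $\mathsf{PaPreOrd}(\mathbb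 C)$ have the same objects as $\mathsf{PreOrd}(\mathbb C)$; a morphism $A\to B$ is a pair $(\alpha,f)$ of a complemented subobject $\alpha\colon A'\rightarrowtail A$ and a morphism $f\colon A'\to B$ in $\mathsf{PreOrd}(\mathbb C)$, up to isomorphism of $A'$; composition is by pullback. Two parallel morphisms $(\alpha_1,f_1)$, $(\alpha_2,f_2)$, with $\alpha_i\colon A_i\rightarrowtail A$, are congruent if there are complemented subobjects $\alpha_0^i\colon A_0\rightarrowtail A_i$ $(i=1,2)$ such that $\alpha_1\alpha_0^1=\alpha_2\alpha_0^2$ is a complemented subobject of $A$, $f_1\alpha_0^1=f_2\alpha_0^2$, and $f_i$ is trivial on the complement of $A_0$ in $A_i$ for $i=1,2$. The *stable category* $\mathsf{Stab}(\mathbb C)$ is the quotient of $\mathsf{PaPreOrd}(\mathbb C)$ by this congruence, and $\Sigma\colon\mathsf{PreOrd}(\mathbb C)\to\mathsf{Stab}(\mathbb C)$ is the functor that is the identity on objects and sends $f\colon A\to B$ to the class of $(1_A,f)$. **Statement.** Let $\mathbb C$ be a $\tau$-pretopos, let $\mathbb X$ be a pointed category with finite coproducts and a torsion theory $(\mathcal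 T,\mathcal F)$, and let $G\colon\mathsf{PreOrd}(\mathbb C)\to\mathbb X$ be a torsion theory functor that preserves finite coproducts. Let $\overline G\colon\mathsf{Stab}(\mathbb C)\to\mathbb X$ be the functor induced by $G$, i.e. the (existing and unique) functor with $\overline G\circ\Sigma=G$. 1. If $G$ sends $\mathcal Z$-cokernels to cokernels (whenever $q$ is a $\mathcal Z$-cokernel of $f$, $G(q)$ is a cokernel of $G(f)$), then $\overline G$ preserves cokernels (whenever $q$ is a cokernel of $f$ in $\mathsf{Stab}(\mathbb C)$, $\overline G(q)$ is a cokernel of $\overline G(f)$). 2. If $G$ sends short $\mathcal Z$-exact sequences to short exact sequences, then $\overline G$ preserves short exact sequences. -/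

import Mathlib

open CategoryTheory CategoryTheory.Limits

universe v u v' u'

namespace PreordStab

/-! ### Trivial morphisms, kernels and cokernels relative to a class of objects -/

section Ideals

variable {D : Type u} [Category.{v} D]

/-- A morphism is `Z`-trivial if it factors through an object of the class `Z`. -/
def IsTrivial (Z : ObjectProperty D) {A B : D} (f : A ⟶ B) : Prop :=
  ∃ (W : D) (_ : Z W) (g : A ⟶ W) (h : W ⟶ B), g ≫ h = f

/-- `k` is a `Z`-kernel of `f`. -/
def IsZKernel (Z : ObjectProperty D) {K A B : D} (k : K ⟶ A) (f : A ⟶ B) : Prop :=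
  IsTrivial Z (k ≫ f) ∧
    ∀ ⦃Y : D⦄ (l : Y ⟶ A), IsTrivial Z (l ≫ f) → ∃! l' : Y ⟶ K, l' ≫ k = l

/-- `q` is a `Z`-cokernel of `f`. -/
def IsZCokernel (Z : ObjectProperty D) {A B Q : D} (f : A ⟶ B) (q : B ⟶ Q) : Prop :=
  IsTrivial Z (f ≫ q) ∧
    ∀ ⦃Y : D⦄ (l : B ⟶ Y), IsTrivial Z (f ≫ l) → ∃! l' : Q ⟶ Y, q ≫ l' = l

/-- `A ⟶ B ⟶ C` is a short `Z`-exact sequence. -/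
def IsShortZExact (Z : ObjectProperty D) {A B C : D} (f : A ⟶ B) (g : B ⟶ C) : Prop :=
  IsZKernel Z f g ∧ IsZCokernel Z f g

/-- The class of zero objects. In a pointed category the trivial morphisms for this class are
exactly the zero morphisms (`isTrivial_zeroObjects_iff`). -/
def zeroObjects (D : Type u) [Category.{v} D] : ObjectProperty D := fun X => IsZero X

theorem isTrivial_zeroObjects_iff [HasZeroObject D] [HasZeroMorphisms D] {A B : D} (f : A ⟶ B) :
    IsTrivial (zeroObjects D) f ↔ f = 0 := by
  constructor
  · rintro ⟨W, hW, g, h, rfl⟩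
    rw [IsZero.eq_zero_of_tgt hW g, zero_comp]
  · rintro rfl
    obtain ⟨W, hW⟩ := HasZeroObject.zero (C := D)
    exact ⟨W, hW, 0, 0, zero_comp⟩

/-- `k` is a kernel of `f` in a pointed category. -/
abbrev IsKer {K A B : D} (k : K ⟶ A) (f : A ⟶ B) : Prop := IsZKernel (zeroObjects D) k f

/-- `q` is a cokernel of `f` in a pointed category. -/
abbrev IsCoker {A B Q : D} (f : A ⟶ B) (q : B ⟶ Q) : Prop := IsZCokernel (zeroObjects D) f q

/-- `0 ⟶ A ⟶ B ⟶ C ⟶ 0` is a short exact sequence in a pointed category. -/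
abbrev IsShortExact {A B C : D} (f : A ⟶ B) (g : B ⟶ C) : Prop :=
  IsShortZExact (zeroObjects D) f g

/-- The pair `(T, F)` of replete full subcategories is a pretorsion theory, with class of
trivial objects `T ⊓ F`. -/
structure IsPretorsionTheory (T F : ObjectProperty D) : Prop where
  replete_left : T.IsClosedUnderIsomorphisms
  replete_right : F.IsClosedUnderIsomorphisms
  hom_trivial : ∀ ⦃A B : D⦄ (f : A ⟶ B), T A → F B → IsTrivial (T ⊓ F) f
  exists_shortExact : ∀ X : D, ∃ (A B : D) (f : A ⟶ X) (g : X ⟶ B),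
    T A ∧ F B ∧ IsShortZExact (T ⊓ F) f g

/-- A torsion theory in a pointed category: a pretorsion theory whose trivial objects are the
zero objects. -/
structure IsTorsionTheory (T F : ObjectProperty D) : Prop extends IsPretorsionTheory T F where
  trivial_eq_zero : T ⊓ F = zeroObjects D

/-- `G` is a torsion theory functor from `(D, T, F)` to `(X, T', F')`. The canonical sequence of
an object is unique up to isomorphism, so the second condition is imposed on every short
`(T ⊓ F)`-exact sequence with left end in `T` and right end in `F`. -/
structure IsTorsionTheoryFunctor {X : Type u'} [Category.{v'} X] (T F : ObjectProperty D)
    (T' F' : ObjectProperty X) (G : D ⥤ X) : Prop where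
  map_torsion : ∀ ⦃A : D⦄, T A → T' (G.obj A)
  map_torsionFree : ∀ ⦃A : D⦄, F A → F' (G.obj A)
  map_canonical : ∀ ⦃A M B : D⦄ (f : A ⟶ M) (g : M ⟶ B), T A → F B →
    IsShortZExact (T ⊓ F) f g → IsShortExact (G.map f) (G.map g)

/-- The subobject `α` is complemented by the subobject `α'`: their intersection is initial, and
their union is the whole object, i.e. any subobject that contains both is everything. -/
structure IsComplement {A A' B : D} (α : A ⟶ B) (α' : A' ⟶ B) : Prop where
  mono_left : Mono α
  mono_right : Mono α'
  disjoint : ∃ (I : D) (p : I ⟶ A) (q : I ⟶ A'), IsPullback p q α α' ∧ Nonempty (IsInitial I)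
  union : ∀ ⦃M : D⦄ (m : M ⟶ B), Mono m → (∃ a : A ⟶ M, a ≫ m = α) →
    (∃ a' : A' ⟶ M, a' ≫ m = α') → IsIso m

/-- `α` is a complemented subobject. -/
def IsComplemented {A B : D} (α : A ⟶ B) : Prop :=
  ∃ (A' : D) (α' : A' ⟶ B), IsComplement α α'

end Ideals

/-! ### Pretoposes -/

/-- A pretopos: a (Barr-)exact and finitary extensive category. -/
class Pretopos (C : Type u) [Category.{v} C] : Prop extends Regular C, FinitaryExtensive C where
  exact : ∀ ⦃R A : C⦄ (p₁ p₂ : R ⟶ A), IsEquivalenceRelation p₁ p₂ →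
    ∃ (B : C) (q : A ⟶ B), IsKernelPair q p₁ p₂

variable {C : Type u} [Category.{v} C]

/-- An internal relation on `A`: a jointly monic pair, i.e. (a representative of) a subobject
of `A × A`. -/
structure IntRel (A : C) where
  obj : C
  fst : obj ⟶ A
  snd : obj ⟶ A
  jointly_mono : JointlyMono₂ fst snd

namespace IntRel

/-- Containment of relations. -/
def Contained {A : C} (ρ σ : IntRel A) : Prop :=
  ∃ h : ρ.obj ⟶ σ.obj, h ≫ σ.fst = ρ.fst ∧ h ≫ σ.snd = ρ.snd

def IsReflexive {A : C} (ρ : IntRel A) : Prop :=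
  ∃ d : A ⟶ ρ.obj, d ≫ ρ.fst = 𝟙 A ∧ d ≫ ρ.snd = 𝟙 A

def IsSymmetric {A : C} (ρ : IntRel A) : Prop :=
  ∃ s : ρ.obj ⟶ ρ.obj, s ≫ ρ.fst = ρ.snd ∧ s ≫ ρ.snd = ρ.fst

/-- `ρ ∩ ρᵒ` is contained in the diagonal; `ρ ∩ ρᵒ` is described by its generalized elements. -/
def IsAntisymmetric {A : C} (ρ : IntRel A) : Prop :=
  ∀ ⦃T : C⦄ (x y : T ⟶ ρ.obj), x ≫ ρ.fst = y ≫ ρ.snd → x ≫ ρ.snd = y ≫ ρ.fst →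
    x ≫ ρ.fst = x ≫ ρ.snd

def IsTransitive [HasPullbacks C] {A : C} (ρ : IntRel A) : Prop :=
  ∃ t : pullback ρ.snd ρ.fst ⟶ ρ.obj,
    t ≫ ρ.fst = pullback.fst ρ.snd ρ.fst ≫ ρ.fst ∧ t ≫ ρ.snd = pullback.snd ρ.snd ρ.fst ≫ ρ.snd

/-- `τ` is the transitive closure of `ρ`: the smallest transitive relation containing `ρ`. -/
def IsTransitiveClosure [HasPullbacks C] {A : C} (ρ τ : IntRel A) : Prop :=
  ρ.Contained τ ∧ τ.IsTransitive ∧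
    ∀ σ : IntRel A, σ.IsTransitive → ρ.Contained σ → τ.Contained σ

theorem hom_ext {A : C} (ρ : IntRel A) {T : C} {x y : T ⟶ ρ.obj}
    (h₁ : x ≫ ρ.fst = y ≫ ρ.fst) (h₂ : x ≫ ρ.snd = y ≫ ρ.snd) : x = y :=
  ρ.jointly_mono.right_cancellation x y h₁ h₂

theorem IsTransitive.elim [HasPullbacks C] {A : C} {ρ : IntRel A} (h : ρ.IsTransitive) {T : C}
    (x y : T ⟶ ρ.obj) (hxy : x ≫ ρ.snd = y ≫ ρ.fst) :
    ∃ z : T ⟶ ρ.obj, z ≫ ρ.fst = x ≫ ρ.fst ∧ z ≫ ρ.snd = y ≫ ρ.snd := by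
  obtain ⟨t, h₁, h₂⟩ := h
  exact ⟨pullback.lift x y hxy ≫ t, by rw [Category.assoc, h₁, pullback.lift_fst_assoc],
    by rw [Category.assoc, h₂, pullback.lift_snd_assoc]⟩

theorem IsTransitive.intro [HasPullbacks C] {A : C} {ρ : IntRel A}
    (h : ∀ ⦃T : C⦄ (x y : T ⟶ ρ.obj), x ≫ ρ.snd = y ≫ ρ.fst →
      ∃ z : T ⟶ ρ.obj, z ≫ ρ.fst = x ≫ ρ.fst ∧ z ≫ ρ.snd = y ≫ ρ.snd) : ρ.IsTransitive :=
  h _ _ pullback.condition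

end IntRel

/-- A `τ`-pretopos: a pretopos in which every relation on an object has a transitive closure. -/
class TauPretopos (C : Type u) [Category.{v} C] : Prop extends Pretopos C where
  exists_transitiveClosure : ∀ ⦃A : C⦄ (ρ : IntRel A), ∃ τ : IntRel A, ρ.IsTransitiveClosure τ

/-! ### Internal preorders -/

/-- An internal preorder: an object with a reflexive and transitive relation. -/
structure IntPreord (C : Type u) [Category.{v} C] [HasPullbacks C] where
  base : C
  rel : IntRel base
  refl : rel.IsReflexive
  trans : rel.IsTransitive

namespace IntPreord

variable [HasPullbacks C]

/-- A morphism of internal preorders: a pair `(f, f̂)` commuting with both projections. -/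
@[ext] structure Hom (A B : IntPreord C) where
  base : A.base ⟶ B.base
  rel : A.rel.obj ⟶ B.rel.obj
  w_fst : rel ≫ B.rel.fst = A.rel.fst ≫ base
  w_snd : rel ≫ B.rel.snd = A.rel.snd ≫ base

instance : Category (IntPreord C) where
  Hom := Hom
  id A := ⟨𝟙 _, 𝟙 _, by simp, by simp⟩
  comp f g := ⟨f.base ≫ g.base, f.rel ≫ g.rel,
    by rw [Category.assoc, g.w_fst, ← Category.assoc, f.w_fst, Category.assoc],
    by rw [Category.assoc, g.w_snd, ← Category.assoc, f.w_snd, Category.assoc]⟩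
  id_comp f := by cases f; simp
  comp_id f := by cases f; simp
  assoc f g h := by simp

@[simp] theorem id_base (A : IntPreord C) : Hom.base (𝟙 A) = 𝟙 A.base := rfl
@[simp] theorem id_rel (A : IntPreord C) : Hom.rel (𝟙 A) = 𝟙 A.rel.obj := rfl
@[simp] theorem comp_base {A B D : IntPreord C} (f : A ⟶ B) (g : B ⟶ D) :
    Hom.base (f ≫ g) = f.base ≫ g.base := rfl
@[simp] theorem comp_rel {A B D : IntPreord C} (f : A ⟶ B) (g : B ⟶ D) :
    Hom.rel (f ≫ g) = f.rel ≫ g.rel := rfl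

@[ext] theorem hom_ext {A B : IntPreord C} {f g : A ⟶ B} (h : f.base = g.base) : f = g :=
  Hom.ext h (B.rel.hom_ext (by rw [f.w_fst, g.w_fst, h]) (by rw [f.w_snd, g.w_snd, h]))

/-- The equivalence relations. -/
def eqRel (C : Type u) [Category.{v} C] [HasPullbacks C] : ObjectProperty (IntPreord C) :=
  fun A => A.rel.IsSymmetric

/-- The partial orders. -/
def parOrd (C : Type u) [Category.{v} C] [HasPullbacks C] : ObjectProperty (IntPreord C) :=
  fun A => A.rel.IsAntisymmetric

/-- The trivial objects `Eq ∩ ParOrd`, i.e. the discrete preorders. -/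
def trivialObj (C : Type u) [Category.{v} C] [HasPullbacks C] : ObjectProperty (IntPreord C) :=
  eqRel C ⊓ parOrd C

end IntPreord

/-! ### Sums in an extensive category -/

section Sums

/-- `Z` is the sum of `X` and `Y` with coprojections `i` and `j`. -/
def IsSum {X Y Z : C} (i : X ⟶ Z) (j : Y ⟶ Z) : Prop :=
  Nonempty (IsColimit (BinaryCofan.mk i j))

namespace IsSum

variable {X Y Z : C} {i : X ⟶ Z} {j : Y ⟶ Z}

theorem symm (h : IsSum i j) : IsSum j i :=
  ⟨BinaryCofan.isColimitFlip h.some⟩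

theorem exists_desc (h : IsSum i j) {W : C} (a : X ⟶ W) (b : Y ⟶ W) :
    ∃ d : Z ⟶ W, i ≫ d = a ∧ j ≫ d = b := by
  obtain ⟨d, h₁, h₂⟩ := BinaryCofan.IsColimit.desc' h.some a b
  exact ⟨d, h₁, h₂⟩

theorem hom_ext (h : IsSum i j) {W : C} {a b : Z ⟶ W} (h₁ : i ≫ a = i ≫ b)
    (h₂ : j ≫ a = j ≫ b) : a = b :=
  BinaryCofan.IsColimit.hom_ext h.some h₁ h₂

theorem of_desc (he : ∀ ⦃W : C⦄ (a : X ⟶ W) (b : Y ⟶ W), ∃ d : Z ⟶ W, i ≫ d = a ∧ j ≫ d = b)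
    (hu : ∀ ⦃W : C⦄ (a b : Z ⟶ W), i ≫ a = i ≫ b → j ≫ a = j ≫ b → a = b) : IsSum i j := by
  choose d h₁ h₂ using he
  exact ⟨BinaryCofan.IsColimit.mk _ (fun a b => d a b) (fun a b => h₁ a b) (fun a b => h₂ a b)
    (fun a b m e₁ e₂ => hu _ _ (e₁.trans (h₁ a b).symm) (e₂.trans (h₂ a b).symm))⟩

theorem comp_iso (h : IsSum i j) {W : C} (e : Z ⟶ W) [IsIso e] : IsSum (i ≫ e) (j ≫ e) := by
  refine of_desc (fun V a b => ?_) (fun V a b h₁ h₂ => ?_)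
  · obtain ⟨d, h₁, h₂⟩ := h.exists_desc a b
    exact ⟨inv e ≫ d, by simpa using h₁, by simpa using h₂⟩
  · rw [← cancel_epi e]
    exact h.hom_ext (by simpa using h₁) (by simpa using h₂)

theorem comp (h : IsSum i j) {K L P : C} {k : K ⟶ X} {l : L ⟶ X} (hkl : IsSum k l)
    {s : L ⟶ P} {t : Y ⟶ P} (hst : IsSum s t) {d : P ⟶ Z} (hs : s ≫ d = l ≫ i) (ht : t ≫ d = j) :
    IsSum (k ≫ i) d := by
  refine of_desc (fun V a b => ?_) (fun V a b h₁ h₂ => ?_)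
  · obtain ⟨x, hx₁, hx₂⟩ := hkl.exists_desc a (s ≫ b)
    obtain ⟨z, hz₁, hz₂⟩ := h.exists_desc x (t ≫ b)
    refine ⟨z, by rw [Category.assoc, hz₁, hx₁], hst.hom_ext ?_ ?_⟩
    · rw [← Category.assoc, hs, Category.assoc, hz₁, hx₂]
    · rw [← Category.assoc, ht, hz₂]
  · refine h.hom_ext (hkl.hom_ext ?_ ?_) ?_
    · simpa using h₁
    · rw [← Category.assoc, ← hs, ← Category.assoc, ← hs, Category.assoc, h₂, Category.assoc]
    · rw [← ht, Category.assoc, h₂, Category.assoc]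

variable [FinitaryExtensive C]

theorem vanKampen (h : IsSum i j) {X' Y' Z' : C} {i' : X' ⟶ Z'} {j' : Y' ⟶ Z'} {a : X' ⟶ X}
    {b : Y' ⟶ Y} {f : Z' ⟶ Z} (ha : a ≫ i = i' ≫ f) (hb : b ≫ j = j' ≫ f) :
    IsSum i' j' ↔ IsPullback i' a f i ∧ IsPullback j' b f j :=
  (BinaryCofan.isVanKampen_iff (BinaryCofan.mk i j)).mp (FinitaryExtensive.vanKampen _ h.some)
    (BinaryCofan.mk i' j') a b f ha hb

theorem mono_left (h : IsSum i j) : Mono i :=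
  FinitaryExtensive.mono_inl_of_isColimit h.some

/-- A generalized element of a sum splits into elements of the summands. -/
theorem cases_elem [HasPullbacks C] (h : IsSum i j) {T : C} (x : T ⟶ Z) :
    ∃ (T₁ T₂ : C) (p : T₁ ⟶ T) (q : T₂ ⟶ T) (a : T₁ ⟶ X) (b : T₂ ⟶ Y),
      IsSum p q ∧ p ≫ x = a ≫ i ∧ q ≫ x = b ≫ j := by
  have h₁ := IsPullback.of_hasPullback x i
  have h₂ := IsPullback.of_hasPullback x j
  exact ⟨_, _, _, _, _, _, (h.vanKampen h₁.w.symm h₂.w.symm).mpr ⟨h₁, h₂⟩, h₁.w, h₂.w⟩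

/-- An element of both summands lives on an initial object. -/
theorem disjoint (h : IsSum i j) {T : C} (x : T ⟶ X) (y : T ⟶ Y) (w : x ≫ i = y ≫ j) :
    Nonempty (T ⟶ ⊥_ C) :=
  ⟨(BinaryCofan.isPullback_initial_to_of_isVanKampen
    (FinitaryExtensive.vanKampen _ h.some)).lift x y w⟩

end IsSum

theorem eq_of_hom_bot [FinitaryExtensive C] {T W : C} (h : Nonempty (T ⟶ ⊥_ C)) (a b : T ⟶ W) :
    a = b := by
  obtain ⟨e⟩ := h
  have := HasStrictInitialObjects.out e initialIsInitial
  rw [← cancel_epi (inv e)]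
  exact initialIsInitial.hom_ext _ _

end Sums

/-! ### Constructions with internal preorders -/

namespace IntPreord

section Constructions

variable [HasPullbacks C]

/-- The discrete preorder on an object. -/
def discrete (X : C) : IntPreord C where
  base := X
  rel := ⟨X, 𝟙 X, 𝟙 X, ⟨fun _ _ _ h _ =>
    (Category.comp_id _).symm.trans (h.trans (Category.comp_id _))⟩⟩
  refl := ⟨𝟙 X, by simp, by simp⟩
  trans := IntRel.IsTransitive.intro fun T x y h => ⟨x, rfl, by simpa using h⟩

theorem exists_of_discrete {X : C} {B : IntPreord C} (f : X ⟶ B.base) :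
    ∃ g : discrete X ⟶ B, g.base = f := by
  obtain ⟨d, h₁, h₂⟩ := B.refl
  refine ⟨⟨f, f ≫ d, ?_, ?_⟩, rfl⟩
  · simp [h₁, discrete]
  · simp [h₂, discrete]

theorem mono_base {A B : IntPreord C} (f : A ⟶ B) [Mono f] : Mono f.base := by
  refine ⟨fun {T} x y h => ?_⟩
  obtain ⟨x', rfl⟩ := exists_of_discrete x
  obtain ⟨y', rfl⟩ := exists_of_discrete y
  have : x' = y' := by
    rw [← cancel_mono f]
    exact hom_ext h
  rw [this]

theorem mono_of_base {A B : IntPreord C} (f : A ⟶ B) (h : Mono f.base) : Mono f :=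
  ⟨fun {T} x y w => hom_ext (by rw [← cancel_mono f.base]; exact congrArg Hom.base w)⟩

theorem isIso_base {A B : IntPreord C} (f : A ⟶ B) [IsIso f] : IsIso f.base :=
  ⟨(inv f).base, congrArg Hom.base (IsIso.hom_inv_id f), congrArg Hom.base (IsIso.inv_hom_id f)⟩

theorem isIso_rel {A B : IntPreord C} (f : A ⟶ B) [IsIso f] : IsIso f.rel :=
  ⟨(inv f).rel, congrArg Hom.rel (IsIso.hom_inv_id f), congrArg Hom.rel (IsIso.inv_hom_id f)⟩

section Components

variable {A B D : IntPreord C} {f : A ⟶ D} {g : B ⟶ D} {P Q : C} {p₁ : P ⟶ A.base}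
  {p₂ : P ⟶ B.base} {q₁ : Q ⟶ A.rel.obj} {q₂ : Q ⟶ B.rel.obj} {r s : Q ⟶ P}

theorem pb_joint_aux (hQ : IsPullback q₁ q₂ f.rel g.rel)
    (hr₁ : r ≫ p₁ = q₁ ≫ A.rel.fst) (hr₂ : r ≫ p₂ = q₂ ≫ B.rel.fst)
    (hs₁ : s ≫ p₁ = q₁ ≫ A.rel.snd) (hs₂ : s ≫ p₂ = q₂ ≫ B.rel.snd) : JointlyMono₂ r s := by
  refine ⟨fun T x y h₁ h₂ => hQ.hom_ext ?_ ?_⟩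
  · apply A.rel.hom_ext
    · rw [Category.assoc, ← hr₁, ← Category.assoc, h₁, Category.assoc, hr₁, Category.assoc]
    · rw [Category.assoc, ← hs₁, ← Category.assoc, h₂, Category.assoc, hs₁, Category.assoc]
  · apply B.rel.hom_ext
    · rw [Category.assoc, ← hr₂, ← Category.assoc, h₁, Category.assoc, hr₂, Category.assoc]
    · rw [Category.assoc, ← hs₂, ← Category.assoc, h₂, Category.assoc, hs₂, Category.assoc]

theorem pb_refl_aux (hP : IsPullback p₁ p₂ f.base g.base) (hQ : IsPullback q₁ q₂ f.rel g.rel)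
    (hr₁ : r ≫ p₁ = q₁ ≫ A.rel.fst) (hr₂ : r ≫ p₂ = q₂ ≫ B.rel.fst)
    (hs₁ : s ≫ p₁ = q₁ ≫ A.rel.snd) (hs₂ : s ≫ p₂ = q₂ ≫ B.rel.snd) :
    ∃ d : P ⟶ Q, d ≫ r = 𝟙 P ∧ d ≫ s = 𝟙 P := by
  obtain ⟨a, ha₁, ha₂⟩ := A.refl
  obtain ⟨b, hb₁, hb₂⟩ := B.refl
  have w : (p₁ ≫ a) ≫ f.rel = (p₂ ≫ b) ≫ g.rel := by
    apply D.rel.hom_ext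
    · rw [Category.assoc, Category.assoc, Category.assoc, Category.assoc, f.w_fst, g.w_fst,
        ← Category.assoc a, ha₁, ← Category.assoc b, hb₁, Category.id_comp, Category.id_comp, hP.w]
    · rw [Category.assoc, Category.assoc, Category.assoc, Category.assoc, f.w_snd, g.w_snd,
        ← Category.assoc a, ha₂, ← Category.assoc b, hb₂, Category.id_comp, Category.id_comp, hP.w]
  refine ⟨hQ.lift _ _ w, hP.hom_ext ?_ ?_, hP.hom_ext ?_ ?_⟩
  · rw [Category.assoc, hr₁, hQ.lift_fst_assoc, Category.assoc, ha₁, Category.comp_id,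
      Category.id_comp]
  · rw [Category.assoc, hr₂, hQ.lift_snd_assoc, Category.assoc, hb₁, Category.comp_id,
      Category.id_comp]
  · rw [Category.assoc, hs₁, hQ.lift_fst_assoc, Category.assoc, ha₂, Category.comp_id,
      Category.id_comp]
  · rw [Category.assoc, hs₂, hQ.lift_snd_assoc, Category.assoc, hb₂, Category.comp_id,
      Category.id_comp]

theorem pb_trans_aux (hP : IsPullback p₁ p₂ f.base g.base) (hQ : IsPullback q₁ q₂ f.rel g.rel)
    (hr₁ : r ≫ p₁ = q₁ ≫ A.rel.fst) (hr₂ : r ≫ p₂ = q₂ ≫ B.rel.fst)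
    (hs₁ : s ≫ p₁ = q₁ ≫ A.rel.snd) (hs₂ : s ≫ p₂ = q₂ ≫ B.rel.snd)
    {T : C} (x y : T ⟶ Q) (h : x ≫ s = y ≫ r) :
    ∃ z : T ⟶ Q, z ≫ r = x ≫ r ∧ z ≫ s = y ≫ s := by
  obtain ⟨a, ha₁, ha₂⟩ := A.trans.elim (x ≫ q₁) (y ≫ q₁) (by
    rw [Category.assoc, ← hs₁, ← Category.assoc, h, Category.assoc, hr₁, Category.assoc])
  obtain ⟨b, hb₁, hb₂⟩ := B.trans.elim (x ≫ q₂) (y ≫ q₂) (by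
    rw [Category.assoc, ← hs₂, ← Category.assoc, h, Category.assoc, hr₂, Category.assoc])
  have w : a ≫ f.rel = b ≫ g.rel := by
    apply D.rel.hom_ext
    · rw [Category.assoc, f.w_fst, Category.assoc, g.w_fst, ← Category.assoc, ha₁,
        ← Category.assoc, hb₁, Category.assoc, Category.assoc, Category.assoc, Category.assoc,
        ← f.w_fst, ← g.w_fst, hQ.w_assoc]
    · rw [Category.assoc, f.w_snd, Category.assoc, g.w_snd, ← Category.assoc, ha₂,
        ← Category.assoc, hb₂, Category.assoc, Category.assoc, Category.assoc, Category.assoc,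
        ← f.w_snd, ← g.w_snd, hQ.w_assoc]
  refine ⟨hQ.lift a b w, hP.hom_ext ?_ ?_, hP.hom_ext ?_ ?_⟩
  · rw [Category.assoc, hr₁, hQ.lift_fst_assoc, ha₁, Category.assoc, Category.assoc, hr₁]
  · rw [Category.assoc, hr₂, hQ.lift_snd_assoc, hb₁, Category.assoc, Category.assoc, hr₂]
  · rw [Category.assoc, hs₁, hQ.lift_fst_assoc, ha₂, Category.assoc, Category.assoc, hs₁]
  · rw [Category.assoc, hs₂, hQ.lift_snd_assoc, hb₂, Category.assoc, Category.assoc, hs₂]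

end Components

/-- The relation on the pullback of internal preorders, computed componentwise. -/
noncomputable def pbRel {A B D : IntPreord C} (f : A ⟶ D) (g : B ⟶ D) :
    IntRel (pullback f.base g.base) where
  obj := pullback f.rel g.rel
  fst := pullback.lift (pullback.fst f.rel g.rel ≫ A.rel.fst)
    (pullback.snd f.rel g.rel ≫ B.rel.fst)
    (by rw [Category.assoc, ← f.w_fst, pullback.condition_assoc, g.w_fst, Category.assoc])
  snd := pullback.lift (pullback.fst f.rel g.rel ≫ A.rel.snd)
    (pullback.snd f.rel g.rel ≫ B.rel.snd)
    (by rw [Category.assoc, ← f.w_snd, pullback.condition_assoc, g.w_snd, Category.assoc])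
  jointly_mono := pb_joint_aux (IsPullback.of_hasPullback f.rel g.rel)
    (pullback.lift_fst _ _ _) (pullback.lift_snd _ _ _) (pullback.lift_fst _ _ _)
    (pullback.lift_snd _ _ _)

/-- The pullback of internal preorders. -/
noncomputable def pb {A B D : IntPreord C} (f : A ⟶ D) (g : B ⟶ D) : IntPreord C where
  base := pullback f.base g.base
  rel := pbRel f g
  refl := pb_refl_aux (IsPullback.of_hasPullback f.base g.base)
    (IsPullback.of_hasPullback f.rel g.rel) (pullback.lift_fst _ _ _) (pullback.lift_snd _ _ _)
    (pullback.lift_fst _ _ _) (pullback.lift_snd _ _ _)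
  trans := IntRel.IsTransitive.intro fun _ x y h => pb_trans_aux (IsPullback.of_hasPullback f.base g.base)
    (IsPullback.of_hasPullback f.rel g.rel) (pullback.lift_fst _ _ _) (pullback.lift_snd _ _ _)
    (pullback.lift_fst _ _ _) (pullback.lift_snd _ _ _) x y h

variable {A B D : IntPreord C} (f : A ⟶ D) (g : B ⟶ D)

/-- The first projection. -/
noncomputable def pbFst : pb f g ⟶ A where
  base := pullback.fst f.base g.base
  rel := pullback.fst f.rel g.rel
  w_fst := (pullback.lift_fst _ _ _).symm
  w_snd := (pullback.lift_fst _ _ _).symm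

/-- The second projection. -/
noncomputable def pbSnd : pb f g ⟶ B where
  base := pullback.snd f.base g.base
  rel := pullback.snd f.rel g.rel
  w_fst := (pullback.lift_snd _ _ _).symm
  w_snd := (pullback.lift_snd _ _ _).symm

theorem isPullback_of_components {P A B D : IntPreord C} {p : P ⟶ A} {q : P ⟶ B} {f : A ⟶ D}
    {g : B ⟶ D} (h₁ : IsPullback p.base q.base f.base g.base)
    (h₂ : IsPullback p.rel q.rel f.rel g.rel) : IsPullback p q f g := by
  have w : p ≫ f = q ≫ g := hom_ext h₁.w
  refine ⟨⟨w⟩, ⟨PullbackCone.IsLimit.mk w (fun s => ⟨h₁.lift s.fst.base s.snd.base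
    (congrArg Hom.base s.condition), h₂.lift s.fst.rel s.snd.rel
    (congrArg Hom.rel s.condition), ?_, ?_⟩) ?_ ?_ ?_⟩⟩
  · apply h₁.hom_ext
    · rw [Category.assoc, ← p.w_fst, h₂.lift_fst_assoc, Category.assoc, h₁.lift_fst, s.fst.w_fst]
    · rw [Category.assoc, ← q.w_fst, h₂.lift_snd_assoc, Category.assoc, h₁.lift_snd, s.snd.w_fst]
  · apply h₁.hom_ext
    · rw [Category.assoc, ← p.w_snd, h₂.lift_fst_assoc, Category.assoc, h₁.lift_fst, s.fst.w_snd]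
    · rw [Category.assoc, ← q.w_snd, h₂.lift_snd_assoc, Category.assoc, h₁.lift_snd, s.snd.w_snd]
  · intro s
    exact hom_ext (h₁.lift_fst _ _ _)
  · intro s
    exact hom_ext (h₁.lift_snd _ _ _)
  · intro s m e₁ e₂
    apply hom_ext
    apply h₁.hom_ext
    · rw [h₁.lift_fst]; exact congrArg Hom.base e₁
    · rw [h₁.lift_snd]; exact congrArg Hom.base e₂

theorem isPullback_pb : IsPullback (pbFst f g) (pbSnd f g) f g :=
  isPullback_of_components (IsPullback.of_hasPullback _ _) (IsPullback.of_hasPullback _ _)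

variable [FinitaryExtensive C]

theorem discreteBot_desc (B : IntPreord C) : ∃ g : discrete (⊥_ C) ⟶ B, ∀ h, h = g := by
  obtain ⟨g, -⟩ := exists_of_discrete (initial.to B.base)
  exact ⟨g, fun h => hom_ext (initialIsInitial.hom_ext _ _)⟩

theorem discreteBot_isInitial : Nonempty (IsInitial (discrete (⊥_ C))) := by
  choose g hg using discreteBot_desc (C := C)
  exact ⟨IsInitial.ofUniqueHom g (fun B m => hg B m)⟩

theorem exists_to_discreteBot (A : IntPreord C) (h : Nonempty (A.base ⟶ ⊥_ C)) :
    Nonempty (A ⟶ discrete (⊥_ C)) := by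
  obtain ⟨e⟩ := h
  exact ⟨⟨e, A.rel.fst ≫ e, eq_of_hom_bot ⟨A.rel.fst ≫ e⟩ _ _,
    eq_of_hom_bot ⟨A.rel.fst ≫ e⟩ _ _⟩⟩

/-- The sum of internal preorders, computed componentwise. -/
theorem exists_sum (A B : IntPreord C) : ∃ (S : IntPreord C) (i : A ⟶ S) (j : B ⟶ S),
    IsSum i.base j.base ∧ IsSum i.rel j.rel := by
  have hb : IsSum (coprod.inl : A.base ⟶ A.base ⨿ B.base) coprod.inr := ⟨coprodIsCoprod _ _⟩
  have hr : IsSum (coprod.inl : A.rel.obj ⟶ A.rel.obj ⨿ B.rel.obj) coprod.inr :=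
    ⟨coprodIsCoprod _ _⟩
  have h₁ := (hb.vanKampen (f := coprod.map A.rel.fst B.rel.fst)
    (a := A.rel.fst) (b := B.rel.fst) (by simp) (by simp)).mp hr
  have hmonol := hb.mono_left
  have hmonor := hb.symm.mono_left
  refine ⟨⟨A.base ⨿ B.base, ⟨A.rel.obj ⨿ B.rel.obj, coprod.map A.rel.fst B.rel.fst,
    coprod.map A.rel.snd B.rel.snd, ⟨fun T x y e₁ e₂ => ?_⟩⟩, ?_, ?_⟩,
    ⟨coprod.inl, coprod.inl, by simp, by simp⟩, ⟨coprod.inr, coprod.inr, by simp, by simp⟩,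
    hb, hr⟩
  · obtain ⟨T₁, T₂, p, q, a, b, hpq, hp, hq⟩ := hr.cases_elem x
    refine hpq.hom_ext ?_ ?_
    · have w : (p ≫ y) ≫ coprod.map A.rel.fst B.rel.fst = (a ≫ A.rel.fst) ≫ coprod.inl := by
        rw [Category.assoc, ← e₁, ← Category.assoc, hp]; simp
      have hy : h₁.1.lift _ _ w ≫ coprod.inl = p ≫ y := h₁.1.lift_fst _ _ w
      rw [hp, ← hy]
      congr 1
      apply A.rel.hom_ext
      · exact (h₁.1.lift_snd _ _ w).symm
      · rw [← cancel_mono (coprod.inl : A.base ⟶ A.base ⨿ B.base)]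
        have := congrArg (p ≫ ·) e₂
        rw [← Category.assoc, ← Category.assoc, hp, ← hy] at this
        simpa only [Category.assoc, coprod.inl_map] using this
    · have w : (q ≫ y) ≫ coprod.map A.rel.fst B.rel.fst = (b ≫ B.rel.fst) ≫ coprod.inr := by
        rw [Category.assoc, ← e₁, ← Category.assoc, hq]; simp
      have hy : h₁.2.lift _ _ w ≫ coprod.inr = q ≫ y := h₁.2.lift_fst _ _ w
      rw [hq, ← hy]
      congr 1
      apply B.rel.hom_ext
      · exact (h₁.2.lift_snd _ _ w).symm
      · rw [← cancel_mono (coprod.inr : B.base ⟶ A.base ⨿ B.base)]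
        have := congrArg (q ≫ ·) e₂
        rw [← Category.assoc, ← Category.assoc, hq, ← hy] at this
        simpa only [Category.assoc, coprod.inr_map] using this
  · obtain ⟨a, ha₁, ha₂⟩ := A.refl
    obtain ⟨b, hb₁, hb₂⟩ := B.refl
    exact ⟨coprod.map a b, by simp [ha₁, hb₁], by simp [ha₂, hb₂]⟩
  · refine IntRel.IsTransitive.intro fun T x y e => ?_
    dsimp only at x y e ⊢
    obtain ⟨T₁, T₂, p, q, a, b, hpq, hp, hq⟩ := hr.cases_elem x
    have w₁ : (p ≫ y) ≫ coprod.map A.rel.fst B.rel.fst = (a ≫ A.rel.snd) ≫ coprod.inl := by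
      rw [Category.assoc, ← e, ← Category.assoc, hp]; simp
    have hy₁ : h₁.1.lift _ _ w₁ ≫ coprod.inl = p ≫ y := h₁.1.lift_fst _ _ w₁
    have w₂ : (q ≫ y) ≫ coprod.map A.rel.fst B.rel.fst = (b ≫ B.rel.snd) ≫ coprod.inr := by
      rw [Category.assoc, ← e, ← Category.assoc, hq]; simp
    have hy₂ : h₁.2.lift _ _ w₂ ≫ coprod.inr = q ≫ y := h₁.2.lift_fst _ _ w₂
    obtain ⟨z₁, hz₁, hz₁'⟩ := A.trans.elim a (h₁.1.lift _ _ w₁) (h₁.1.lift_snd _ _ w₁).symm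
    obtain ⟨z₂, hz₂, hz₂'⟩ := B.trans.elim b (h₁.2.lift _ _ w₂) (h₁.2.lift_snd _ _ w₂).symm
    obtain ⟨z, hz, hz'⟩ := hpq.exists_desc (z₁ ≫ coprod.inl) (z₂ ≫ coprod.inr)
    refine ⟨z, hpq.hom_ext ?_ ?_, hpq.hom_ext ?_ ?_⟩
    · rw [← Category.assoc, hz, ← Category.assoc, hp]
      simp only [Category.assoc, coprod.inl_map]
      rw [← Category.assoc, hz₁, Category.assoc]
    · rw [← Category.assoc, hz', ← Category.assoc, hq]
      simp only [Category.assoc, coprod.inr_map]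
      rw [← Category.assoc, hz₂, Category.assoc]
    · rw [← Category.assoc, hz, ← Category.assoc, ← hy₁]
      simp only [Category.assoc, coprod.inl_map]
      rw [← Category.assoc, hz₁', Category.assoc]
    · rw [← Category.assoc, hz', ← Category.assoc, ← hy₂]
      simp only [Category.assoc, coprod.inr_map]
      rw [← Category.assoc, hz₂', Category.assoc]

end Constructions

end IntPreord

/-! ### Complemented subobjects of internal preorders -/

namespace IntPreord

section Complemented

variable [HasPullbacks C] [FinitaryExtensive C]

/-- A subobject of an internal preorder is complemented by another one exactly when both the
underlying objects and the relations form a sum. -/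
theorem isComplement_iff {A A' B : IntPreord C} (α : A ⟶ B) (α' : A' ⟶ B) :
    IsComplement α α' ↔ IsSum α.base α'.base ∧ IsSum α.rel α'.rel := by
  constructor
  · intro h
    have := h.mono_left
    have := h.mono_right
    have := mono_base α
    have := mono_base α'
    obtain ⟨S, i, j, hb, hr⟩ := exists_sum A A'
    obtain ⟨m, hm₁, hm₂⟩ := hb.exists_desc α.base α'.base
    obtain ⟨n, hn₁, hn₂⟩ := hr.exists_desc α.rel α'.rel
    let d : S ⟶ B := ⟨m, n,
      hr.hom_ext
        (by rw [← Category.assoc, hn₁, α.w_fst, ← Category.assoc, i.w_fst, Category.assoc, hm₁])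
        (by rw [← Category.assoc, hn₂, α'.w_fst, ← Category.assoc, j.w_fst, Category.assoc, hm₂]),
      hr.hom_ext
        (by rw [← Category.assoc, hn₁, α.w_snd, ← Category.assoc, i.w_snd, Category.assoc, hm₁])
        (by rw [← Category.assoc, hn₂, α'.w_snd, ← Category.assoc, j.w_snd, Category.assoc, hm₂])⟩
    have hbot : ∀ {T : C} (x : T ⟶ A.base) (y : T ⟶ A'.base), x ≫ α.base = y ≫ α'.base →
        Nonempty (T ⟶ ⊥_ C) := by
      intro T x y w
      obtain ⟨x', rfl⟩ := exists_of_discrete x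
      obtain ⟨y', rfl⟩ := exists_of_discrete y
      obtain ⟨I, p, q, hI, ⟨hinit⟩⟩ := h.disjoint
      exact ⟨(hI.lift x' y' (hom_ext w) ≫ hinit.to (discrete (⊥_ C))).base⟩
    have hmono : Mono m := by
      refine ⟨fun {T} x y hxy => ?_⟩
      obtain ⟨T₁, T₂, p, q, a, b, hpq, hp, hq⟩ := hb.cases_elem x
      refine hpq.hom_ext ?_ ?_
      · obtain ⟨U₁, U₂, p', q', a', b', hpq', hp', hq'⟩ := hb.cases_elem (p ≫ y)
        refine hpq'.hom_ext ?_ ?_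
        · rw [hp', hp, ← Category.assoc]
          congr 1
          rw [← cancel_mono α.base, ← hm₁, Category.assoc, ← Category.assoc a, ← hp,
            Category.assoc, hxy, ← Category.assoc a', ← hp']
          simp
        · apply eq_of_hom_bot
          apply hbot (q' ≫ a) b'
          rw [← hm₁, ← hm₂, ← Category.assoc b', ← hq', Category.assoc, ← Category.assoc a, ← hp]
          simp [hxy]
      · obtain ⟨U₁, U₂, p', q', a', b', hpq', hp', hq'⟩ := hb.cases_elem (q ≫ y)
        refine hpq'.hom_ext ?_ ?_
        · apply eq_of_hom_bot
          apply hbot a' (p' ≫ b)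
          rw [← hm₁, ← hm₂, ← Category.assoc a', ← hp', Category.assoc p' b, ← Category.assoc b,
            ← hq]
          simp [hxy]
        · rw [hq', hq, ← Category.assoc]
          congr 1
          rw [← cancel_mono α'.base, ← hm₂, Category.assoc, ← Category.assoc b, ← hq,
            Category.assoc, hxy, ← Category.assoc b', ← hq']
          simp
    have := h.union d (mono_of_base d hmono) ⟨i, hom_ext hm₁⟩ ⟨j, hom_ext hm₂⟩
    have h₁ : IsIso m := isIso_base d
    have h₂ : IsIso n := isIso_rel d
    have e₁ := hb.comp_iso m
    have e₂ := hr.comp_iso n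
    rw [hm₁, hm₂] at e₁
    rw [hn₁, hn₂] at e₂
    exact ⟨e₁, e₂⟩
  · rintro ⟨hb, hr⟩
    refine ⟨mono_of_base _ hb.mono_left, mono_of_base _ hb.symm.mono_left, ?_, ?_⟩
    · obtain ⟨hI⟩ := discreteBot_isInitial (C := C)
      refine ⟨discrete (⊥_ C), hI.to _, hI.to _, ⟨⟨hI.hom_ext _ _⟩, ?_⟩, ⟨hI⟩⟩
      have key : ∀ s : PullbackCone α α', Nonempty (s.pt ⟶ discrete (⊥_ C)) := fun s =>
        exists_to_discreteBot _ (hb.disjoint s.fst.base s.snd.base (congrArg Hom.base s.condition))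
      exact ⟨PullbackCone.IsLimit.mk _ (fun s => (key s).some)
        (fun s => hom_ext (eq_of_hom_bot ⟨(key s).some.base⟩ _ _))
        (fun s => hom_ext (eq_of_hom_bot ⟨(key s).some.base⟩ _ _))
        (fun s m _ _ => hom_ext (eq_of_hom_bot ⟨(key s).some.base⟩ _ _))⟩
    · rintro M m hm ⟨a, ha⟩ ⟨a', ha'⟩
      obtain ⟨d, hd₁, hd₂⟩ := hb.exists_desc a.base a'.base
      obtain ⟨e, he₁, he₂⟩ := hr.exists_desc a.rel a'.rel
      let s : B ⟶ M := ⟨d, e,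
        hr.hom_ext
          (by rw [← Category.assoc, he₁, a.w_fst, ← Category.assoc, α.w_fst, Category.assoc, hd₁])
          (by rw [← Category.assoc, he₂, a'.w_fst, ← Category.assoc, α'.w_fst, Category.assoc,
            hd₂]),
        hr.hom_ext
          (by rw [← Category.assoc, he₁, a.w_snd, ← Category.assoc, α.w_snd, Category.assoc, hd₁])
          (by rw [← Category.assoc, he₂, a'.w_snd, ← Category.assoc, α'.w_snd, Category.assoc,
            hd₂])⟩
      have hs : s ≫ m = 𝟙 B := by
        apply hom_ext
        apply hb.hom_ext
        · rw [comp_base, ← Category.assoc, hd₁, ← comp_base, ha, id_base, Category.comp_id]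
        · rw [comp_base, ← Category.assoc, hd₂, ← comp_base, ha', id_base, Category.comp_id]
      exact ⟨s, by rw [← cancel_mono m, Category.assoc, hs, Category.id_comp, Category.comp_id], hs⟩

theorem isComplemented_id (A : IntPreord C) : IsComplemented (𝟙 A) := by
  obtain ⟨g, -⟩ := discreteBot_desc A
  refine ⟨_, g, (isComplement_iff _ _).mpr ⟨?_, ?_⟩⟩
  · refine IsSum.of_desc (fun W a b => ⟨a, Category.id_comp _, initialIsInitial.hom_ext _ _⟩)
      (fun W a b h _ => by rwa [id_base, Category.id_comp, Category.id_comp] at h)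
  · refine IsSum.of_desc (fun W a b => ⟨a, Category.id_comp _, initialIsInitial.hom_ext _ _⟩)
      (fun W a b h _ => by rwa [id_rel, Category.id_comp, Category.id_comp] at h)

theorem isComplemented_comp {A B D : IntPreord C} {α : A ⟶ B} {β : B ⟶ D}
    (hα : IsComplemented α) (hβ : IsComplemented β) : IsComplemented (α ≫ β) := by
  obtain ⟨A', α', hα⟩ := hα
  obtain ⟨B', β', hβ⟩ := hβ
  obtain ⟨hα₁, hα₂⟩ := (isComplement_iff _ _).mp hα
  obtain ⟨hβ₁, hβ₂⟩ := (isComplement_iff _ _).mp hβ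
  obtain ⟨S, i, j, hb, hr⟩ := exists_sum A' B'
  obtain ⟨m, hm₁, hm₂⟩ := hb.exists_desc (α'.base ≫ β.base) β'.base
  obtain ⟨n, hn₁, hn₂⟩ := hr.exists_desc (α'.rel ≫ β.rel) β'.rel
  let d : S ⟶ D := ⟨m, n,
    hr.hom_ext
      (by rw [← Category.assoc, hn₁, Category.assoc, β.w_fst, ← Category.assoc, α'.w_fst,
        ← Category.assoc, i.w_fst, Category.assoc, Category.assoc, hm₁])
      (by rw [← Category.assoc, hn₂, β'.w_fst, ← Category.assoc, j.w_fst, Category.assoc, hm₂]),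
    hr.hom_ext
      (by rw [← Category.assoc, hn₁, Category.assoc, β.w_snd, ← Category.assoc, α'.w_snd,
        ← Category.assoc, i.w_snd, Category.assoc, Category.assoc, hm₁])
      (by rw [← Category.assoc, hn₂, β'.w_snd, ← Category.assoc, j.w_snd, Category.assoc, hm₂])⟩
  exact ⟨S, d, (isComplement_iff _ _).mpr
    ⟨hβ₁.comp hα₁ hb hm₁ hm₂, hβ₂.comp hα₂ hr hn₁ hn₂⟩⟩

theorem isComplemented_pb {A B D : IntPreord C} (f : A ⟶ D) (β : B ⟶ D)
    (hβ : IsComplemented β) : IsComplemented (pbFst f β) := by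
  obtain ⟨B', β', hβ⟩ := hβ
  obtain ⟨h₁, h₂⟩ := (isComplement_iff _ _).mp hβ
  refine ⟨pb f β', pbFst f β', (isComplement_iff _ _).mpr ⟨?_, ?_⟩⟩
  · have k₁ := IsPullback.of_hasPullback f.base β.base
    have k₂ := IsPullback.of_hasPullback f.base β'.base
    exact (h₁.vanKampen k₁.w.symm k₂.w.symm).mpr ⟨k₁, k₂⟩
  · have k₁ := IsPullback.of_hasPullback f.rel β.rel
    have k₂ := IsPullback.of_hasPullback f.rel β'.rel
    exact (h₂.vanKampen k₁.w.symm k₂.w.symm).mpr ⟨k₁, k₂⟩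

end Complemented

end IntPreord

/-! ### Partial morphisms -/

open IntPreord

section Partial

variable [HasPullbacks C]

/-- A representative of a partial morphism: a complemented subobject `incl` of the source,
and a morphism defined on it. -/
structure PartialSpan (A B : IntPreord C) where
  dom : IntPreord C
  incl : dom ⟶ A
  complemented : IsComplemented incl
  map : dom ⟶ B

namespace PartialSpan

/-- Two representatives define the same partial morphism if they differ by an isomorphism of
their domains. -/
def Rel {A B : IntPreord C} (s t : PartialSpan A B) : Prop :=
  ∃ e : s.dom ≅ t.dom, e.hom ≫ t.incl = s.incl ∧ e.hom ≫ t.map = s.map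

instance setoid (A B : IntPreord C) : Setoid (PartialSpan A B) where
  r := Rel
  iseqv :=
    { refl := fun s => ⟨Iso.refl _, by simp, by simp⟩
      symm := fun ⟨e, h₁, h₂⟩ => ⟨e.symm, by simp [← h₁], by simp [← h₂]⟩
      trans := fun ⟨e, h₁, h₂⟩ ⟨e', h₁', h₂'⟩ =>
        ⟨e ≪≫ e', by simp [h₁, h₁'], by simp [h₂, h₂']⟩ }

variable [FinitaryExtensive C]

/-- The identity partial morphism, or more generally the partial morphism of a morphism. -/
def ofHom {A B : IntPreord C} (f : A ⟶ B) : PartialSpan A B := ⟨A, 𝟙 A, isComplemented_id A, f⟩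

/-- Composition, by pulling back the domain of the second partial morphism. -/
noncomputable def comp {A B D : IntPreord C} (s : PartialSpan A B) (t : PartialSpan B D) :
    PartialSpan A D where
  dom := pb s.map t.incl
  incl := pbFst s.map t.incl ≫ s.incl
  complemented := isComplemented_comp (isComplemented_pb _ _ t.complemented) s.complemented
  map := pbSnd s.map t.incl ≫ t.map

theorem comp_rel_of_isPullback {A B D : IntPreord C} (s : PartialSpan A B) (t : PartialSpan B D)
    (r : PartialSpan A D) (p : r.dom ⟶ s.dom) (q : r.dom ⟶ t.dom)
    (h : IsPullback p q s.map t.incl) (h₁ : p ≫ s.incl = r.incl) (h₂ : q ≫ t.map = r.map) :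
    Rel (s.comp t) r := by
  let e : pb s.map t.incl ≅ r.dom := (isPullback_pb s.map t.incl).isoIsPullback _ _ h
  have e₁ : e.hom ≫ p = pbFst s.map t.incl := IsPullback.isoIsPullback_hom_fst _ _ _ _
  have e₂ : e.hom ≫ q = pbSnd s.map t.incl := IsPullback.isoIsPullback_hom_snd _ _ _ _
  have k₁ : e.hom ≫ r.incl = pbFst s.map t.incl ≫ s.incl := by
    rw [← h₁, ← Category.assoc, e₁]
  have k₂ : e.hom ≫ r.map = pbSnd s.map t.incl ≫ t.map := by
    rw [← h₂, ← Category.assoc, e₂]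
  exact ⟨e, k₁, k₂⟩

theorem comp_congr {A B D : IntPreord C} {s s' : PartialSpan A B} {t t' : PartialSpan B D}
    (hs : Rel s s') (ht : Rel t t') : Rel (s.comp t) (s'.comp t') := by
  obtain ⟨e, h₁, h₂⟩ := hs
  obtain ⟨e', h₁', h₂'⟩ := ht
  have k : IsPullback (pbFst s'.map t'.incl ≫ e.inv) (pbSnd s'.map t'.incl ≫ e'.inv) s.map
      t.incl := by
    refine IsPullback.of_iso (isPullback_pb s'.map t'.incl) (Iso.refl _) e.symm e'.symm
      (Iso.refl _) (by simp) (by simp) ?_ ?_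
    · simp [← h₂]
    · simp [← h₁']
  exact comp_rel_of_isPullback s t (s'.comp t') _ _ k
    (by simp [← h₁, comp]) (by simp [← h₂', comp])

theorem id_comp_rel {A B : IntPreord C} (s : PartialSpan A B) : Rel ((ofHom (𝟙 A)).comp s) s :=
  comp_rel_of_isPullback _ _ _ s.incl (𝟙 _) IsPullback.of_id_snd (Category.comp_id _)
    (Category.id_comp _)

theorem comp_id_rel {A B : IntPreord C} (s : PartialSpan A B) : Rel (s.comp (ofHom (𝟙 B))) s :=
  comp_rel_of_isPullback _ _ _ (𝟙 _) s.map IsPullback.of_id_fst (Category.id_comp _)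
    (Category.comp_id _)

theorem assoc_rel {A B D E : IntPreord C} (s : PartialSpan A B) (t : PartialSpan B D)
    (r : PartialSpan D E) : Rel (s.comp (t.comp r)) ((s.comp t).comp r) := by
  have h₁ := isPullback_pb s.map t.incl
  have h₂ := isPullback_pb t.map r.incl
  have h₃ := isPullback_pb (pbSnd s.map t.incl ≫ t.map) r.incl
  have w : (pbFst (pbSnd s.map t.incl ≫ t.map) r.incl ≫ pbSnd s.map t.incl) ≫ t.map =
      pbSnd (pbSnd s.map t.incl ≫ t.map) r.incl ≫ r.incl := by
    rw [Category.assoc]; exact h₃.w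
  have k : IsPullback (pbFst (pbSnd s.map t.incl ≫ t.map) r.incl) (h₂.lift _ _ w)
      (pbSnd s.map t.incl) (pbFst t.map r.incl) := IsPullback.of_bot' h₃ h₂
  have e : h₂.lift _ _ w ≫ pbSnd t.map r.incl = pbSnd (pbSnd s.map t.incl ≫ t.map) r.incl :=
    h₂.lift_snd _ _ w
  have e' : h₂.lift _ _ w ≫ pbSnd t.map r.incl ≫ r.map =
      pbSnd (pbSnd s.map t.incl ≫ t.map) r.incl ≫ r.map := by rw [← Category.assoc, e]
  exact comp_rel_of_isPullback s (t.comp r) ((s.comp t).comp r) _ _ (k.paste_horiz h₁)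
    (Category.assoc _ _ _) e'

/-- A partial morphism of a morphism composes as morphisms do. -/
theorem ofHom_comp_rel {A B D : IntPreord C} (f : A ⟶ B) (g : B ⟶ D) :
    Rel ((ofHom f).comp (ofHom g)) (ofHom (f ≫ g)) :=
  comp_rel_of_isPullback _ _ _ (𝟙 _) f IsPullback.of_id_fst (Category.id_comp _) rfl

end PartialSpan

end Partial

/-! ### The category of partial morphisms and the stable category -/

section Stable

/-- The objects of the category of partial morphisms: the internal preorders. -/
structure PaPreord (C : Type u) [Category.{v} C] [HasPullbacks C] where
  obj : IntPreord C

variable [HasPullbacks C] [FinitaryExtensive C]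

/-- The category of partial morphisms of internal preorders. -/
noncomputable instance : Category (PaPreord C) where
  Hom A B := _root_.Quotient (PartialSpan.setoid A.obj B.obj)
  id A := _root_.Quotient.mk _ (PartialSpan.ofHom (𝟙 A.obj))
  comp := _root_.Quotient.map₂ PartialSpan.comp
    (fun _ _ hs _ _ ht => PartialSpan.comp_congr hs ht)
  id_comp := by
    rintro A B ⟨s⟩
    exact _root_.Quotient.sound (PartialSpan.id_comp_rel s)
  comp_id := by
    rintro A B ⟨s⟩
    exact _root_.Quotient.sound (PartialSpan.comp_id_rel s)
  assoc := by
    rintro A B D E ⟨s⟩ ⟨t⟩ ⟨r⟩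
    exact _root_.Quotient.sound (Setoid.symm (PartialSpan.assoc_rel s t r))

/-- The partial morphism represented by a span. -/
def PaPreord.mkHom {A B : IntPreord C} (s : PartialSpan A B) :
    (PaPreord.mk A : PaPreord C) ⟶ PaPreord.mk B := _root_.Quotient.mk _ s

/-- The functor `I` from internal preorders to partial morphisms. -/
noncomputable def PaPreord.incl (C : Type u) [Category.{v} C] [HasPullbacks C]
    [FinitaryExtensive C] : IntPreord C ⥤ PaPreord C where
  obj A := ⟨A⟩
  map f := PaPreord.mkHom (PartialSpan.ofHom f)
  map_id _ := rfl
  map_comp f g := (_root_.Quotient.sound (PartialSpan.ofHom_comp_rel f g)).symm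

/-- There is a congruence diagram between two parallel representatives `(α₁, f₁)`, `(α₂, f₂)`:
`A₀` is a complemented subobject of both domains, the two restrictions to `A₀` agree, and on the
complement of `A₀` in each domain the morphism is trivial. -/
def CongruenceDiagram {A B : IntPreord C} (s t : PartialSpan A B) : Prop :=
  ∃ (A₀ A₁ A₂ : IntPreord C) (i₁ : A₀ ⟶ s.dom) (i₂ : A₀ ⟶ t.dom) (c₁ : A₁ ⟶ s.dom)
    (c₂ : A₂ ⟶ t.dom),
    IsComplement i₁ c₁ ∧ IsComplement i₂ c₂ ∧
    i₁ ≫ s.incl = i₂ ≫ t.incl ∧ IsComplemented (i₁ ≫ s.incl) ∧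
    i₁ ≫ s.map = i₂ ≫ t.map ∧
    IsTrivial (trivialObj C) (c₁ ≫ s.map) ∧ IsTrivial (trivialObj C) (c₂ ≫ t.map)

/-- The congruence on partial morphisms: there is a congruence diagram between
representatives. -/
def stableRel (C : Type u) [Category.{v} C] [HasPullbacks C] [FinitaryExtensive C] :
    HomRel (PaPreord C) := fun A B F G =>
  ∃ s t : PartialSpan A.obj B.obj, PaPreord.mkHom s = F ∧ PaPreord.mkHom t = G ∧
    CongruenceDiagram s t

/-- The stable category. -/
abbrev Stab (C : Type u) [Category.{v} C] [HasPullbacks C] [FinitaryExtensive C] :=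
  CategoryTheory.Quotient (stableRel C)

/-- The canonical functor `Σ` from internal preorders to the stable category. -/
noncomputable def toStab (C : Type u) [Category.{v} C] [HasPullbacks C] [FinitaryExtensive C] :
    IntPreord C ⥤ Stab C :=
  PaPreord.incl C ⋙ CategoryTheory.Quotient.functor (stableRel C)

end Stable

end PreordStab

/-!
# Cokernels and short exact sequences in the stable category of internal preorders

A morphism into `B` that is defined on a complemented subobject of `A` is the same thing as a total
morphism `A ⟶ B + 1`: the complement is sent to the added point. Composition of partial morphisms
becomes `g ≫ extendHom h`, where `extendHom h : B + 1 ⟶ E + 1` preserves the added point, and the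
congruence defining the stable category becomes *stable equality* (`StablyEq`): the source splits
into a summand on which the two morphisms agree and a summand on which both are trivial
(`PartialSpan.congruenceDiagram_iff`). Stable equality is a congruence, so two morphisms into
`B + 1` have the same class in the stable category if and only if they are stably equal
(`Stab.mk_eq_iff`).

The inclusion `B ⟶ B + 1` becomes an isomorphism in the stable category, and the stable morphism
represented by `h : A ⟶ B + 1` corresponds under it to the image `Σ h` of `h`
(`Stab.mk_comp_toStab_map`). A torsion theory functor `G` that preserves finite coproducts sends
trivial objects to zero objects, so it inverts `B ⟶ B + 1` and identifies stably equal morphisms.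
Hence it factors through the stable category (`Stab.exists_lift`), uniquely
(`Stab.functor_ext`).

The functor `Σ` preserves kernels and cokernels (`Stab.isKer_toStab_map`,
`Stab.isCoker_toStab_map`). For a cokernel `q` of `f : A ⟶ B`, the point is that a decomposition of
`B` into two summands is a morphism from `B` to the trivial object `1 + 1`, so that it always
descends along `q`. Kernels exist in the category of internal preorders, and so do cokernels when
the base is a `τ`-pretopos: quotients and generated preorders are built from transitive closures and
exactness. Therefore every stable morphism together with its cokernel is, up to isomorphism, the
image under `Σ` of some `f'` with its cokernel `q'`, and a short exact sequence in the stable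
category is, up to isomorphism, the image of a short exact sequence formed by `q'` and its kernel.
Both claims follow by applying `G` to these lifts.
-/

namespace PreordStab

theorem isSum_iff_nonempty_isColimit {D : Type u} [Category.{v} D] {X Y : D}
    (c : BinaryCofan X Y) : IsSum c.inl c.inr ↔ Nonempty (IsColimit c) :=
  ⟨fun ⟨k⟩ => ⟨k.ofIsoColimit (isoBinaryCofanMk c).symm⟩,
    fun ⟨k⟩ => ⟨k.ofIsoColimit (isoBinaryCofanMk c)⟩⟩

namespace IntPreord

/-! ### The category of internal preorders is extensive -/

section Extensive

variable {C : Type u} [Category.{v} C] [HasPullbacks C]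

/-- A componentwise sum of internal preorders is a sum. -/
theorem isSum_of_components {A B S : IntPreord C} {i : A ⟶ S} {j : B ⟶ S}
    (hb : IsSum i.base j.base) (hr : IsSum i.rel j.rel) : IsSum i j := by
  refine IsSum.of_desc (fun W a b => ?_) (fun W a b h₁ h₂ => ?_)
  · obtain ⟨m, hm₁, hm₂⟩ := hb.exists_desc a.base b.base
    obtain ⟨n, hn₁, hn₂⟩ := hr.exists_desc a.rel b.rel
    refine ⟨⟨m, n, hr.hom_ext ?_ ?_, hr.hom_ext ?_ ?_⟩, hom_ext hm₁, hom_ext hm₂⟩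
    · rw [reassoc_of% hn₁, a.w_fst, reassoc_of% i.w_fst, hm₁]
    · rw [reassoc_of% hn₂, b.w_fst, reassoc_of% j.w_fst, hm₂]
    · rw [reassoc_of% hn₁, a.w_snd, reassoc_of% i.w_snd, hm₁]
    · rw [reassoc_of% hn₂, b.w_snd, reassoc_of% j.w_snd, hm₂]
  · exact hom_ext (hb.hom_ext (congrArg Hom.base h₁) (congrArg Hom.base h₂))

theorem isPullback_iff {P A B D : IntPreord C} {p : P ⟶ A} {q : P ⟶ B} {f : A ⟶ D} {g : B ⟶ D} :
    IsPullback p q f g ↔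
      IsPullback p.base q.base f.base g.base ∧ IsPullback p.rel q.rel f.rel g.rel := by
  refine ⟨fun h => ?_, fun h => isPullback_of_components h.1 h.2⟩
  let e := (isPullback_pb f g).isoIsPullback _ _ h
  have e₁ : e.inv ≫ pbFst f g = p := IsPullback.isoIsPullback_inv_fst _ _ _ _
  have e₂ : e.inv ≫ pbSnd f g = q := IsPullback.isoIsPullback_inv_snd _ _ _ _
  have := isIso_base e.inv
  have := isIso_rel e.inv
  rw [← e₁, ← e₂]
  exact ⟨IsPullback.of_iso (IsPullback.of_hasPullback f.base g.base) (asIso e.inv.base).symm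
      (Iso.refl _) (Iso.refl _) (Iso.refl _)
      ((Category.comp_id _).trans ((asIso e.inv.base).inv_hom_id_assoc _).symm)
      ((Category.comp_id _).trans ((asIso e.inv.base).inv_hom_id_assoc _).symm)
      (by simp) (by simp),
    IsPullback.of_iso (IsPullback.of_hasPullback f.rel g.rel) (asIso e.inv.rel).symm
      (Iso.refl _) (Iso.refl _) (Iso.refl _)
      ((Category.comp_id _).trans ((asIso e.inv.rel).inv_hom_id_assoc _).symm)
      ((Category.comp_id _).trans ((asIso e.inv.rel).inv_hom_id_assoc _).symm)
      (by simp) (by simp)⟩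

instance : HasPullbacks (IntPreord C) :=
  have : ∀ {A B D : IntPreord C} {f : A ⟶ D} {g : B ⟶ D}, HasLimit (cospan f g) :=
    fun {_ _ _ f g} => (isPullback_pb f g).hasPullback
  hasPullbacks_of_hasLimit_cospan _

instance [HasTerminal C] : HasTerminal (IntPreord C) := by
  refine (IsTerminal.ofUniqueHom (Y := discrete (⊤_ C)) (fun A => (Hom.mk (terminal.from _)
    (terminal.from _) (terminalIsTerminal.hom_ext _ _) (terminalIsTerminal.hom_ext _ _) :
      Hom A (discrete (⊤_ C)))) (fun _ _ => hom_ext (terminalIsTerminal.hom_ext _ _))).hasTerminal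

variable [FinitaryExtensive C]

theorem isSum_iff {A B S : IntPreord C} {i : A ⟶ S} {j : B ⟶ S} :
    IsSum i j ↔ IsSum i.base j.base ∧ IsSum i.rel j.rel := by
  refine ⟨fun h => ?_, fun h => isSum_of_components h.1 h.2⟩
  obtain ⟨S', i', j', hb, hr⟩ := exists_sum A B
  have h' := isSum_of_components hb hr
  obtain ⟨d, hd₁, hd₂⟩ := h'.exists_desc i j
  obtain ⟨e, he₁, he₂⟩ := h.exists_desc i' j'
  have : IsIso d := ⟨e, h'.hom_ext (by rw [reassoc_of% hd₁, he₁, Category.comp_id])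
    (by rw [reassoc_of% hd₂, he₂, Category.comp_id]),
    h.hom_ext (by rw [reassoc_of% he₁, hd₁, Category.comp_id])
    (by rw [reassoc_of% he₂, hd₂, Category.comp_id])⟩
  have := isIso_base d
  have := isIso_rel d
  rw [← hd₁, ← hd₂]
  exact ⟨hb.comp_iso d.base, hr.comp_iso d.rel⟩

theorem isComplement_iff_isSum {A A' B : IntPreord C} (α : A ⟶ B) (α' : A' ⟶ B) :
    IsComplement α α' ↔ IsSum α α' :=
  (isComplement_iff α α').trans isSum_iff.symm

instance : HasFiniteCoproducts (IntPreord C) := by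
  have : HasInitial (IntPreord C) := discreteBot_isInitial.some.hasInitial
  have : ∀ A B : IntPreord C, HasColimit (pair A B) := fun A B => by
    obtain ⟨S, i, j, hb, hr⟩ := exists_sum A B
    exact ⟨⟨_, (isSum_of_components hb hr).some⟩⟩
  have : HasBinaryCoproducts (IntPreord C) := hasBinaryCoproducts_of_hasColimit_pair _
  exact hasFiniteCoproducts_of_has_binary_and_initial

instance : FinitaryExtensive (IntPreord C) where
  van_kampen' {X Y} c hc := by
    have h : IsSum c.inl c.inr := (isSum_iff_nonempty_isColimit c).mpr ⟨hc⟩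
    obtain ⟨hb, hr⟩ := isSum_iff.mp h
    rw [BinaryCofan.isVanKampen_iff]
    intro X' Y' c' a b f ha hb'
    exact (isSum_iff_nonempty_isColimit c').symm.trans (isSum_iff.trans
      ((and_congr (hb.vanKampen (congrArg Hom.base ha) (congrArg Hom.base hb'))
        (hr.vanKampen (congrArg Hom.rel ha) (congrArg Hom.rel hb'))).trans
        (and_and_and_comm.trans (and_congr isPullback_iff.symm isPullback_iff.symm))))

end Extensive

end IntPreord

/-! ### Morphisms relative to a class of trivial objects -/

section Ideal

variable {D : Type u} [Category.{v} D] {Z : ObjectProperty D}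

theorem IsTrivial.precomp {A B E : D} {f : B ⟶ E} (h : IsTrivial Z f) (g : A ⟶ B) :
    IsTrivial Z (g ≫ f) := by
  obtain ⟨W, hW, a, b, rfl⟩ := h
  exact ⟨W, hW, g ≫ a, b, Category.assoc _ _ _⟩

theorem IsTrivial.postcomp {A B E : D} {f : A ⟶ B} (h : IsTrivial Z f) (g : B ⟶ E) :
    IsTrivial Z (f ≫ g) := by
  obtain ⟨W, hW, a, b, rfl⟩ := h
  exact ⟨W, hW, a, b ≫ g, (Category.assoc _ _ _).symm⟩

theorem IsTrivial.of_tgt {A B : D} (hB : Z B) (f : A ⟶ B) : IsTrivial Z f :=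
  ⟨B, hB, f, 𝟙 B, Category.comp_id f⟩

theorem IsZKernel.mono {K A B : D} {k : K ⟶ A} {f : A ⟶ B} (h : IsZKernel Z k f) : Mono k :=
  ⟨fun {T} x y w => (h.2 (x ≫ k) (by rw [Category.assoc]; exact h.1.precomp x)).unique rfl w.symm⟩

theorem IsZCokernel.epi {A B Q : D} {f : A ⟶ B} {q : B ⟶ Q} (h : IsZCokernel Z f q) : Epi q :=
  ⟨fun {T} x y w => (h.2 (q ≫ x) (by rw [← Category.assoc]; exact h.1.postcomp x)).unique rfl
    w.symm⟩

/-- Kernels reflect triviality, since every morphism from a trivial object into the domain of `f`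
lifts to the kernel. -/
theorem IsZKernel.isTrivial_of_comp {K A B T : D} {k : K ⟶ A} {f : A ⟶ B} (h : IsZKernel Z k f)
    {u : T ⟶ K} (hu : IsTrivial Z (u ≫ k)) : IsTrivial Z u := by
  have := h.mono
  obtain ⟨W, hW, a, b, hab⟩ := hu
  obtain ⟨b', hb', -⟩ := h.2 b ⟨W, hW, 𝟙 W, b ≫ f, Category.id_comp _⟩
  exact ⟨W, hW, a, b', by rw [← cancel_mono k, Category.assoc, hb', hab]⟩

/-- Cokernels reflect triviality, dually to `IsZKernel.isTrivial_of_comp`. -/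
theorem IsZCokernel.isTrivial_of_comp {A B Q T : D} {f : A ⟶ B} {q : B ⟶ Q}
    (h : IsZCokernel Z f q) {u : Q ⟶ T} (hu : IsTrivial Z (q ≫ u)) : IsTrivial Z u := by
  have := h.epi
  obtain ⟨W, hW, a, b, hab⟩ := hu
  obtain ⟨a', ha', -⟩ := h.2 a (IsTrivial.of_tgt hW _)
  exact ⟨W, hW, a', b, by rw [← cancel_epi q, reassoc_of% ha', hab]⟩

/-- A cokernel is a cokernel of its kernel. -/
theorem IsZCokernel.isShortZExact {A B Q K : D} {f : A ⟶ B} {q : B ⟶ Q} {k : K ⟶ B}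
    (hq : IsZCokernel Z f q) (hk : IsZKernel Z k q) : IsShortZExact Z k q := by
  refine ⟨hk, hk.1, fun Y l hl => hq.2 l ?_⟩
  obtain ⟨t, rfl, -⟩ := hk.2 f hq.1
  rw [Category.assoc]
  exact hl.precomp t

theorem IsZCokernel.comp_iso {A B Q A' B' Q' : D} {f : A ⟶ B} {q : B ⟶ Q} {f' : A' ⟶ B'}
    {q' : B' ⟶ Q'} (h : IsZCokernel Z f q) (c : A ≅ A') (e : B ≅ B') (d : Q ≅ Q')
    (hf : f ≫ e.hom = c.hom ≫ f') (hq : e.hom ≫ q' = q ≫ d.hom) : IsZCokernel Z f' q' := by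
  have hf' : f' = c.inv ≫ f ≫ e.hom := by rw [hf, c.inv_hom_id_assoc]
  have hq' : q' = e.inv ≫ q ≫ d.hom := by rw [← hq, e.inv_hom_id_assoc]
  subst hf' hq'
  refine ⟨by simpa using (h.1.postcomp d.hom).precomp c.inv, fun Y l hl => ?_⟩
  obtain ⟨m, hm, hm'⟩ := h.2 (e.hom ≫ l) (by simpa using hl.precomp c.hom)
  refine ⟨d.inv ≫ m, by simp [hm], fun n hn => ?_⟩
  rw [← hm' (d.hom ≫ n) (by simp [← hn]), d.inv_hom_id_assoc]

theorem IsZKernel.comp_iso {K A B K' A' B' : D} {k : K ⟶ A} {f : A ⟶ B} {k' : K' ⟶ A'}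
    {f' : A' ⟶ B'} (h : IsZKernel Z k f) (c : K ≅ K') (e : A ≅ A') (d : B ≅ B')
    (hk : k ≫ e.hom = c.hom ≫ k') (hf : e.hom ≫ f' = f ≫ d.hom) : IsZKernel Z k' f' := by
  have hf' : f' = e.inv ≫ f ≫ d.hom := by rw [← hf, e.inv_hom_id_assoc]
  have hk' : k' = c.inv ≫ k ≫ e.hom := by rw [hk, c.inv_hom_id_assoc]
  subst hf' hk'
  refine ⟨by simpa using (h.1.postcomp d.hom).precomp c.inv, fun Y l hl => ?_⟩
  obtain ⟨m, hm, hm'⟩ := h.2 (l ≫ e.inv) (by simpa using hl.postcomp d.inv)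
  refine ⟨m ≫ c.hom, by simp [reassoc_of% hm], fun n hn => ?_⟩
  rw [← hm' (n ≫ c.inv) (by simp [← hn]), Category.assoc, c.inv_hom_id, Category.comp_id]

theorem IsZCokernel.exists_iso {A B Q Q' : D} {f : A ⟶ B} {q : B ⟶ Q} {q' : B ⟶ Q'}
    (h : IsZCokernel Z f q) (h' : IsZCokernel Z f q') : ∃ d : Q ≅ Q', q ≫ d.hom = q' := by
  have := h.epi
  have := h'.epi
  obtain ⟨d, hd, -⟩ := h.2 q' h'.1
  obtain ⟨e, he, -⟩ := h'.2 q h.1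
  exact ⟨⟨d, e, by rw [← cancel_epi q, reassoc_of% hd, he, Category.comp_id],
    by rw [← cancel_epi q', reassoc_of% he, hd, Category.comp_id]⟩, hd⟩

theorem IsZKernel.exists_iso {K K' A B : D} {f : A ⟶ B} {k : K ⟶ A} {k' : K' ⟶ A}
    (h : IsZKernel Z k f) (h' : IsZKernel Z k' f) : ∃ d : K ≅ K', d.hom ≫ k' = k := by
  have := h.mono
  have := h'.mono
  obtain ⟨d, hd, -⟩ := h'.2 k h.1
  obtain ⟨e, he, -⟩ := h.2 k' h'.1
  exact ⟨⟨d, e, by rw [← cancel_mono k, Category.assoc, he, hd, Category.id_comp],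
    by rw [← cancel_mono k', Category.assoc, hd, he, Category.id_comp]⟩, hd⟩

end Ideal

/-! ### Stable equality of morphisms -/

/-- A class of objects closed under binary sums and summands, and containing the terminal
object: what is needed of the trivial objects to work with decompositions into summands. -/
structure IsSummandClosed {D : Type u} [Category.{v} D] [HasTerminal D] (Z : ObjectProperty D) :
    Prop where
  sum : ∀ ⦃X Y S : D⦄ (i : X ⟶ S) (j : Y ⟶ S), IsSum i j → Z X → Z Y → Z S
  summand : ∀ ⦃X Y S : D⦄ (i : X ⟶ S) (j : Y ⟶ S), IsSum i j → Z S → Z X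
  terminal : Z (⊤_ D)

section Stable

variable {D : Type u} [Category.{v} D]

theorem isSum_coprod [HasBinaryCoproducts D] (X Y : D) :
    IsSum (coprod.inl : X ⟶ X ⨿ Y) coprod.inr := ⟨coprodIsCoprod X Y⟩

theorem isSum_id_initial [HasInitial D] (X : D) : IsSum (𝟙 X) (initial.to X) :=
  IsSum.of_desc (fun W a b => ⟨a, Category.id_comp a, initialIsInitial.hom_ext _ _⟩)
    (fun W a b h _ => by simpa using h)

theorem IsSum.map {X : Type u'} [Category.{v'} X] (G : D ⥤ X)
    [PreservesFiniteCoproducts G] {A B S : D} {i : A ⟶ S} {j : B ⟶ S} (h : IsSum i j) :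
    IsSum (G.map i) (G.map j) :=
  ⟨mapIsColimitOfPreservesOfIsColimit G i j h.some⟩

theorem IsSum.isIso_of_isZero {A B S : D} {i : A ⟶ S} {j : B ⟶ S}
    (h : IsSum i j) (hB : IsZero B) : IsIso i := by
  obtain ⟨r, hr, -⟩ := h.exists_desc (𝟙 A) (hB.to_ A)
  exact ⟨r, hr, h.hom_ext (by rw [reassoc_of% hr, Category.comp_id]) (hB.eq_of_src _ _)⟩

/-- Two parallel morphisms are stably equal if their source splits into a summand where they
agree and a summand where both are trivial. -/
def StablyEq (Z : ObjectProperty D) {A B : D} (h h' : A ⟶ B) : Prop :=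
  ∃ (A₀ A₁ : D) (i : A₀ ⟶ A) (j : A₁ ⟶ A), IsSum i j ∧ i ≫ h = i ≫ h' ∧
    IsTrivial Z (j ≫ h) ∧ IsTrivial Z (j ≫ h')

variable {Z : ObjectProperty D}

namespace StablyEq

variable {A B : D} {h h' : A ⟶ B}

theorem symm (e : StablyEq Z h h') : StablyEq Z h' h := by
  obtain ⟨_, _, i, j, hij, h₁, h₂, h₃⟩ := e
  exact ⟨_, _, i, j, hij, h₁.symm, h₃, h₂⟩

theorem postcomp (e : StablyEq Z h h') {E : D} (r : B ⟶ E) : StablyEq Z (h ≫ r) (h' ≫ r) := by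
  obtain ⟨_, _, i, j, hij, w, h₂, h₃⟩ := e
  refine ⟨_, _, i, j, hij, by rw [reassoc_of% w], ?_, ?_⟩
  · simpa using h₂.postcomp r
  · simpa using h₃.postcomp r

end StablyEq

variable [FinitaryExtensive D]

/-- Binary sums are stable under pullback. -/
theorem IsSum.isSum_pullback {X Y S T : D} {i : X ⟶ S} {j : Y ⟶ S} (h : IsSum i j)
    {P Q : D} {f : T ⟶ S} {p : P ⟶ T} {p' : P ⟶ X} {q : Q ⟶ T} {q' : Q ⟶ Y}
    (h₁ : IsPullback p p' f i) (h₂ : IsPullback q q' f j) : IsSum p q :=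
  (h.vanKampen h₁.w.symm h₂.w.symm).mpr ⟨h₁, h₂⟩

namespace StablyEq

variable {A B : D} {h h' : A ⟶ B}

theorem of_isTrivial (h₁ : IsTrivial Z h) (h₂ : IsTrivial Z h') : StablyEq Z h h' :=
  ⟨_, _, _, _, (isSum_id_initial A).symm, initialIsInitial.hom_ext _ _, h₁.precomp _,
    h₂.precomp _⟩

theorem precomp [HasPullbacks D] (e : StablyEq Z h h') {T : D} (p : T ⟶ A) :
    StablyEq Z (p ≫ h) (p ≫ h') := by
  obtain ⟨_, _, i, j, hij, w, h₂, h₃⟩ := e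
  have k₁ := IsPullback.of_hasPullback p i
  have k₂ := IsPullback.of_hasPullback p j
  refine ⟨_, _, _, _, hij.isSum_pullback k₁ k₂, ?_, ?_, ?_⟩
  · rw [reassoc_of% k₁.w, reassoc_of% k₁.w, w]
  · rw [reassoc_of% k₂.w]
    exact h₂.precomp _
  · rw [reassoc_of% k₂.w]
    exact h₃.precomp _

end StablyEq

variable [HasTerminal D]

theorem IsSum.isTrivial (hZ : IsSummandClosed Z) {X Y S B : D} {i : X ⟶ S} {j : Y ⟶ S}
    (h : IsSum i j) {f : S ⟶ B} (h₁ : IsTrivial Z (i ≫ f)) (h₂ : IsTrivial Z (j ≫ f)) :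
    IsTrivial Z f := by
  obtain ⟨V, hV, a, b, hab⟩ := h₁
  obtain ⟨W, hW, c, d, hcd⟩ := h₂
  obtain ⟨m, hm₁, hm₂⟩ := h.exists_desc (a ≫ coprod.inl) (c ≫ coprod.inr : Y ⟶ V ⨿ W)
  exact ⟨V ⨿ W, hZ.sum _ _ (isSum_coprod V W) hV hW, m, coprod.desc b d,
    h.hom_ext (by rw [reassoc_of% hm₁, coprod.inl_desc, hab])
      (by rw [reassoc_of% hm₂, coprod.inr_desc, hcd])⟩

theorem isTrivial_of_hom_bot (hZ : IsSummandClosed Z) {A B : D} (h : Nonempty (A ⟶ ⊥_ D))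
    (f : A ⟶ B) : IsTrivial Z f :=
  ⟨⊥_ D, hZ.summand _ _ (isSum_id_initial (⊤_ D)).symm hZ.terminal, h.some, initial.to B,
    eq_of_hom_bot h _ _⟩

namespace StablyEq

variable {A B : D} {h h' : A ⟶ B}

theorem refl (hZ : IsSummandClosed Z) (h : A ⟶ B) : StablyEq Z h h :=
  ⟨_, _, _, _, isSum_id_initial A, rfl, isTrivial_of_hom_bot hZ ⟨𝟙 _⟩ _,
    isTrivial_of_hom_bot hZ ⟨𝟙 _⟩ _⟩

theorem isTrivial (hZ : IsSummandClosed Z) (e : StablyEq Z h h') (h₁ : IsTrivial Z h) :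
    IsTrivial Z h' := by
  obtain ⟨_, _, i, j, hij, w, -, h₃⟩ := e
  exact hij.isTrivial hZ (w ▸ h₁.precomp i) h₃

end StablyEq

variable [HasPullbacks D]

/-- A morphism into a summand is trivial if it is trivial as a morphism into the sum. -/
theorem IsSum.isTrivial_of_comp (hZ : IsSummandClosed Z) {X Y S A : D} {i : X ⟶ S} {j : Y ⟶ S}
    (h : IsSum i j) {f : A ⟶ X} (hf : IsTrivial Z (f ≫ i)) : IsTrivial Z f := by
  obtain ⟨W, hW, a, b, hab⟩ := hf
  have h₁ := IsPullback.of_hasPullback b i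
  have h₂ := IsPullback.of_hasPullback b j
  exact ⟨_, hZ.summand _ _ ((h.vanKampen h₁.w.symm h₂.w.symm).mpr ⟨h₁, h₂⟩) hW,
    h₁.lift a f hab, _, h₁.lift_snd _ _ _⟩

theorem StablyEq.trans {A B : D} {h h' h'' : A ⟶ B} (hZ : IsSummandClosed Z)
    (e : StablyEq Z h h') (e' : StablyEq Z h' h'') : StablyEq Z h h'' := by
  obtain ⟨A₀, A₁, i, j, hij, w, h₂, h₃⟩ := e
  have ht := (e'.precomp j).isTrivial hZ h₃
  obtain ⟨B₀, B₁, i', j', hij', w', h₂', h₃'⟩ := e'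
  have k₁ := IsPullback.of_hasPullback i i'
  have k₂ := IsPullback.of_hasPullback i j'
  have hs := hij'.isSum_pullback k₁ k₂
  -- On `A₀ ∩ B₀` all three agree. The rest of the source is the sum of `A₀ ∩ B₁`, where `h` agrees
  -- with the trivial `h'`, and of `A₁`, where `h''` is stably equal to the trivial `h'`.
  have hc := isSum_coprod (pullback i j') A₁
  refine ⟨_, _, _, coprod.desc (pullback.fst i j' ≫ i) j,
    hij.comp hs hc (coprod.inl_desc _ _) (coprod.inr_desc _ _),
    ?_, hc.isTrivial hZ ?_ ?_, hc.isTrivial hZ ?_ ?_⟩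
  · rw [Category.assoc, w, reassoc_of% k₁.w, w', Category.assoc, reassoc_of% k₁.w]
  · rw [coprod.inl_desc_assoc, Category.assoc, w, reassoc_of% k₂.w]
    exact h₂'.precomp _
  · rwa [coprod.inr_desc_assoc]
  · rw [coprod.inl_desc_assoc, Category.assoc, reassoc_of% k₂.w]
    exact h₃'.precomp _
  · rwa [coprod.inr_desc_assoc]

end Stable

/-! ### Partial morphisms as total morphisms into an object with an added point -/

section Partial

variable {D : Type u} [Category.{v} D] [FinitaryExtensive D] [HasTerminal D]

/-- The object `B + 1`. Morphisms `A ⟶ B + 1` correspond to morphisms into `B` defined on a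
summand of `A`. -/
noncomputable abbrev WithPoint (B : D) : D := B ⨿ ⊤_ D

/-- The inclusion of an object in the object with an added point. -/
noncomputable abbrev toWithPoint (B : D) : B ⟶ WithPoint B := coprod.inl

/-- The added point. -/
noncomputable abbrev point (B : D) : ⊤_ D ⟶ WithPoint B := coprod.inr

/-- The nowhere defined morphism, constant at the added point. -/
noncomputable abbrev undefinedHom (A B : D) : A ⟶ WithPoint B := terminal.from A ≫ point B

/-- The extension of `h : A ⟶ B + 1` to `A + 1` that preserves the added point. The composite of
the partial morphisms `g` and `h` is `g ≫ extendHom h`. -/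
noncomputable abbrev extendHom {A B : D} (h : A ⟶ WithPoint B) : WithPoint A ⟶ WithPoint B :=
  coprod.desc h (point B)

@[simp]
theorem toWithPoint_extendHom {A B : D} (h : A ⟶ WithPoint B) :
    toWithPoint A ≫ extendHom h = h := coprod.inl_desc _ _

@[simp]
theorem point_extendHom {A B : D} (h : A ⟶ WithPoint B) :
    point A ≫ extendHom h = point B := coprod.inr_desc _ _

theorem comp_undefinedHom {A A' B : D} (f : A ⟶ A') :
    f ≫ undefinedHom A' B = undefinedHom A B := by
  rw [← Category.assoc, terminal.comp_from]

theorem isSum_withPoint (B : D) : IsSum (toWithPoint B) (point B) := isSum_coprod _ _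

variable {A B E A' A'' : D} {i : A' ⟶ A} {f : A' ⟶ B} {h h' : A ⟶ WithPoint B}

/-- The square `i ≫ h = f ≫ toWithPoint B` is a pullback precisely when `h` represents the partial
morphism that is `f` on the summand `i`; here this is deduced from the values of `h` on a
complement. -/
theorem isPullback_of_isSum {c : A'' ⟶ A} (hs : IsSum i c) (hi : i ≫ h = f ≫ toWithPoint B)
    (hc : c ≫ h = undefinedHom A'' B) : IsPullback i f h (toWithPoint B) :=
  (((isSum_withPoint B).vanKampen hi.symm (hc.symm : terminal.from A'' ≫ point B = _)).mp hs).1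

theorem exists_isPullback {c : A'' ⟶ A} (hs : IsSum i c) (f : A' ⟶ B) :
    ∃ h : A ⟶ WithPoint B, IsPullback i f h (toWithPoint B) := by
  obtain ⟨h, h₁, h₂⟩ := hs.exists_desc (f ≫ toWithPoint B) (undefinedHom A'' B)
  exact ⟨h, isPullback_of_isSum hs h₁ h₂⟩

theorem isPullback_id (f : A ⟶ B) : IsPullback (𝟙 A) f (f ≫ toWithPoint B) (toWithPoint B) :=
  isPullback_of_isSum (isSum_id_initial A) (Category.id_comp _) (initialIsInitial.hom_ext _ _)

/-- The domain of definition of a partial morphism is a summand, on whose complement the morphism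
is constant at the added point. -/
theorem exists_isSum_of_isPullback [HasPullbacks D]
    (hp : IsPullback i f h (toWithPoint B)) :
    ∃ (A'' : D) (c : A'' ⟶ A), IsSum i c ∧ c ≫ h = undefinedHom A'' B := by
  have hq := IsPullback.of_hasPullback h (point B)
  refine ⟨_, _, (isSum_withPoint B).isSum_pullback hp hq, ?_⟩
  rw [hq.w]
  exact congrArg (· ≫ point B) (terminalIsTerminal.hom_ext _ _)

variable {Z : ObjectProperty D}

theorem isTrivial_point (hZ : IsSummandClosed Z) (B : D) : IsTrivial Z (point B) :=
  ⟨_, hZ.terminal, 𝟙 _, _, Category.id_comp _⟩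

theorem isTrivial_undefinedHom (hZ : IsSummandClosed Z) (A B : D) :
    IsTrivial Z (undefinedHom A B) :=
  (IsTrivial.of_tgt hZ.terminal _).postcomp _

theorem isTrivial_extendHom (hZ : IsSummandClosed Z) (hh : IsTrivial Z h) :
    IsTrivial Z (extendHom h) :=
  (isSum_withPoint A).isTrivial hZ (by rwa [toWithPoint_extendHom])
    (by rw [point_extendHom]; exact isTrivial_point hZ B)

theorem StablyEq.extend (hZ : IsSummandClosed Z) (e : StablyEq Z h h') :
    StablyEq Z (extendHom h) (extendHom h') := by
  obtain ⟨A₀, A₁, i, j, hij, w, h₂, h₃⟩ := e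
  -- The added point goes with the summand on which both morphisms are trivial.
  have hA := isSum_withPoint A₁
  have hd₁ : toWithPoint A₁ ≫ coprod.desc (j ≫ toWithPoint A) (point A) = j ≫ toWithPoint A :=
    coprod.inl_desc _ _
  have hd₂ : point A₁ ≫ coprod.desc (j ≫ toWithPoint A) (point A) = point A := coprod.inr_desc _ _
  have key : ∀ k : A ⟶ WithPoint B, IsTrivial Z (j ≫ k) →
      IsTrivial Z (coprod.desc (j ≫ toWithPoint A) (point A) ≫ extendHom k) := fun k hk =>
    hA.isTrivial hZ (by rwa [reassoc_of% hd₁, toWithPoint_extendHom])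
      (by rw [reassoc_of% hd₂, point_extendHom]; exact isTrivial_point hZ B)
  exact ⟨_, _, _, _, (isSum_withPoint A).comp hij hA hd₁ hd₂,
    by rw [Category.assoc, Category.assoc, toWithPoint_extendHom, toWithPoint_extendHom, w],
    key h h₂, key h' h₃⟩

variable [HasPullbacks D]

/-- A partial morphism is represented by at most one morphism. -/
theorem eq_of_isPullback (hp : IsPullback i f h (toWithPoint B))
    (hp' : IsPullback i f h' (toWithPoint B)) : h = h' := by
  obtain ⟨A'', c, hs, hc⟩ := exists_isSum_of_isPullback hp
  refine hs.hom_ext (hp.w.trans hp'.w.symm) ?_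
  obtain ⟨T₁, T₂, p, q, a, b, hpq, e₁, e₂⟩ := (isSum_withPoint B).cases_elem (c ≫ h')
  rw [hc]
  refine hpq.hom_ext ?_ ?_
  · -- On this part of the complement `h'` is defined, so the part is empty.
    have w : (p ≫ c) ≫ h' = a ≫ toWithPoint B := by rw [Category.assoc, e₁]
    exact eq_of_hom_bot (hs.disjoint (hp'.lift _ _ w) p (hp'.lift_fst _ _ w)) _ _
  · rw [e₂, comp_undefinedHom]
    exact congrArg (· ≫ point B) (terminalIsTerminal.hom_ext _ _)

/-- The composite of partial morphisms, defined by pulling back the domain of the second, is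
represented by the composite `h ≫ extendHom k` of their representing morphisms. -/
theorem isPullback_comp {B' T : D} {j : B' ⟶ B} {g : B' ⟶ E} {k : B ⟶ WithPoint E} {p : T ⟶ A'}
    {q : T ⟶ B'} (hp : IsPullback i f h (toWithPoint B)) (hk : IsPullback j g k (toWithPoint E))
    (hT : IsPullback p q f j) :
    IsPullback (p ≫ i) (q ≫ g) (h ≫ extendHom k) (toWithPoint E) := by
  obtain ⟨B'', c, hs, hc⟩ := exists_isSum_of_isPullback hk
  have hsum := (isSum_withPoint B).comp hs (isSum_withPoint B'')
    (coprod.inl_desc (c ≫ toWithPoint B) (point B)) (coprod.inr_desc _ _)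
  refine (hT.paste_horiz hp).paste_vert (isPullback_of_isSum hsum ?_ ?_)
  · rw [Category.assoc, coprod.inl_desc, hk.w]
  · refine (isSum_withPoint B'').hom_ext ?_ ?_
    · rw [coprod.inl_desc_assoc, Category.assoc, coprod.inl_desc, hc, comp_undefinedHom]
    · rw [coprod.inr_desc_assoc, coprod.inr_desc, comp_undefinedHom, undefinedHom,
        terminalIsTerminal.hom_ext (terminal.from (⊤_ D)) (𝟙 _), Category.id_comp]

theorem isTrivial_comp_toWithPoint_iff (hZ : IsSummandClosed Z) {f : A ⟶ B} :
    IsTrivial Z (f ≫ toWithPoint B) ↔ IsTrivial Z f :=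
  ⟨(isSum_withPoint B).isTrivial_of_comp hZ, fun hf => hf.postcomp _⟩

/-- The composite of the partial morphism `h` with the inclusion of `B` in `B + 1` is stably equal
to `h` viewed as a total morphism into `B + 1`: they differ only where `h` is constant at the added
point, and there both are trivial. -/
theorem stablyEq_comp_toWithPoint (hZ : IsSummandClosed Z) (h : A ⟶ WithPoint B) :
    StablyEq Z (h ≫ extendHom (toWithPoint B ≫ toWithPoint (WithPoint B)))
      (h ≫ toWithPoint (WithPoint B)) := by
  refine StablyEq.precomp ⟨_, _, _, _, isSum_withPoint B, coprod.inl_desc _ _, ?_, ?_⟩ h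
  · rw [point_extendHom]
    exact isTrivial_point hZ _
  · exact (isTrivial_point hZ _).postcomp _

/-! ### The congruence on partial morphisms as stable equality -/

variable {A₁ A₂ : D} {α₁ : A₁ ⟶ A} {α₂ : A₂ ⟶ A} {f₁ : A₁ ⟶ B} {f₂ : A₂ ⟶ B}

/-- If `f` is trivial off the summand `A₀` of its domain of definition, then the representing
morphism `h` is trivial off `A₀`: outside the domain of `f` it is constant. -/
theorem isTrivial_of_complement (hZ : IsSummandClosed Z) (hp : IsPullback i f h (toWithPoint B))
    {A₀ A₀' C₀ : D} {i₀ : A₀ ⟶ A'} {c₀ : A₀' ⟶ A'} {c : C₀ ⟶ A} (h₀ : IsSum i₀ c₀)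
    (hc : IsSum (i₀ ≫ i) c) (ht : IsTrivial Z (c₀ ≫ f)) : IsTrivial Z (c ≫ h) := by
  obtain ⟨T₁, T₂, p, q, a, b, hpq, e₁, e₂⟩ := (isSum_withPoint B).cases_elem (c ≫ h)
  refine hpq.isTrivial hZ ?_ ?_
  · let x : T₁ ⟶ A' := hp.lift (p ≫ c) a (by rw [Category.assoc, e₁])
    have hx₁ : x ≫ i = p ≫ c := hp.lift_fst _ _ _
    have hx₂ : x ≫ f = a := hp.lift_snd _ _ _
    rw [e₁, ← hx₂]
    refine IsTrivial.postcomp ?_ _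
    obtain ⟨U₁, U₂, p', q', a', b', hpq', e₁', e₂'⟩ := h₀.cases_elem x
    refine hpq'.isTrivial hZ (isTrivial_of_hom_bot hZ (hc.disjoint a' (p' ≫ p) ?_) _) ?_
    · rw [← reassoc_of% e₁', hx₁, Category.assoc]
    · rw [reassoc_of% e₂']
      exact ht.precomp b'
  · rw [e₂]
    exact (IsTrivial.of_tgt hZ.terminal b).postcomp _

/-- Partial morphisms related by a congruence diagram are represented by stably equal morphisms. -/
theorem stablyEq_of_congruence (hZ : IsSummandClosed Z) {h₁ h₂ : A ⟶ WithPoint B}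
    (hp₁ : IsPullback α₁ f₁ h₁ (toWithPoint B)) (hp₂ : IsPullback α₂ f₂ h₂ (toWithPoint B))
    {A₀ A₁' A₂' C₀ : D} {i₁ : A₀ ⟶ A₁} {i₂ : A₀ ⟶ A₂} {c₁ : A₁' ⟶ A₁} {c₂ : A₂' ⟶ A₂}
    {c : C₀ ⟶ A} (hs₁ : IsSum i₁ c₁) (hs₂ : IsSum i₂ c₂) (hα : i₁ ≫ α₁ = i₂ ≫ α₂)
    (hc : IsSum (i₁ ≫ α₁) c) (hf : i₁ ≫ f₁ = i₂ ≫ f₂) (ht₁ : IsTrivial Z (c₁ ≫ f₁))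
    (ht₂ : IsTrivial Z (c₂ ≫ f₂)) : StablyEq Z h₁ h₂ := by
  refine ⟨_, _, _, _, hc, ?_, isTrivial_of_complement hZ hp₁ hs₁ hc ht₁,
    isTrivial_of_complement hZ hp₂ hs₂ (hα ▸ hc) ht₂⟩
  rw [Category.assoc, hp₁.w, reassoc_of% hf, ← hp₂.w, hα, Category.assoc]

/-- Partial morphisms represented by stably equal morphisms are related by a congruence diagram. -/
theorem StablyEq.exists_congruence (hZ : IsSummandClosed Z) {h₁ h₂ : A ⟶ WithPoint B}
    (e : StablyEq Z h₁ h₂)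
    (hp₁ : IsPullback α₁ f₁ h₁ (toWithPoint B)) (hp₂ : IsPullback α₂ f₂ h₂ (toWithPoint B)) :
    ∃ (A₀ A₁' A₂' : D) (i₁ : A₀ ⟶ A₁) (i₂ : A₀ ⟶ A₂) (c₁ : A₁' ⟶ A₁) (c₂ : A₂' ⟶ A₂),
      IsSum i₁ c₁ ∧ IsSum i₂ c₂ ∧ i₁ ≫ α₁ = i₂ ≫ α₂ ∧ i₁ ≫ f₁ = i₂ ≫ f₂ ∧
      IsTrivial Z (c₁ ≫ f₁) ∧ IsTrivial Z (c₂ ≫ f₂) := by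
  obtain ⟨B₀, B₁, i, j, hij, w, ht₁, ht₂⟩ := e
  have k₁ := IsPullback.of_hasPullback α₁ i
  have l₁ := IsPullback.of_hasPullback α₁ j
  have l₂ := IsPullback.of_hasPullback α₂ j
  -- `A₀` is the part of `B₀` where `h₁`, or equivalently `h₂`, is defined.
  have m := k₁.flip.paste_vert hp₁
  rw [w] at m
  have wm : (pullback.snd α₁ i ≫ i) ≫ h₂ = (pullback.fst α₁ i ≫ f₁) ≫ toWithPoint B := by
    rw [Category.assoc, m.w]
  have a₁ := hp₂.lift_fst _ _ wm
  have a₂ := hp₂.lift_snd _ _ wm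
  rw [← a₂] at m
  have k₂ := (IsPullback.of_bot m a₁.symm hp₂).flip
  refine ⟨_, _, _, _, _, _, _, hij.isSum_pullback k₁ l₁, hij.isSum_pullback k₂ l₂,
    k₁.w.trans a₁.symm, a₂.symm, ?_, ?_⟩
  · rw [← isTrivial_comp_toWithPoint_iff hZ, Category.assoc, ← hp₁.w, reassoc_of% l₁.w]
    exact ht₁.precomp _
  · rw [← isTrivial_comp_toWithPoint_iff hZ, Category.assoc, ← hp₂.w, reassoc_of% l₂.w]
    exact ht₂.precomp _

end Partial

/-! ### Kernels and cokernels up to stable equality -/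

section KernelsCokernels

variable {D : Type u} [Category.{v} D] {Z : ObjectProperty D}

/-- A kernel is a monomorphism up to stable equality. -/
theorem IsZKernel.stablyEq_of_comp {K A B T : D} {k : K ⟶ A} {g : A ⟶ B} (hk : IsZKernel Z k g)
    {x y : T ⟶ K} (e : StablyEq Z (x ≫ k) (y ≫ k)) : StablyEq Z x y := by
  have := hk.mono
  obtain ⟨_, _, i, j, hij, w, h₂, h₃⟩ := e
  exact ⟨_, _, i, j, hij, by rwa [← cancel_mono k, Category.assoc, Category.assoc],
    hk.isTrivial_of_comp (by rwa [Category.assoc]), hk.isTrivial_of_comp (by rwa [Category.assoc])⟩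

variable [FinitaryExtensive D] [HasTerminal D]

/-- A cokernel is an epimorphism up to stable equality. The decomposition of `B` descends to `Q`,
because its classifying morphism `B ⟶ 1 + 1` has a trivial target and so factors through `q`. -/
theorem IsZCokernel.stablyEq_of_comp (hZ : IsSummandClosed Z) {A B Q Y : D} {f : A ⟶ B}
    {q : B ⟶ Q} (hq : IsZCokernel Z f q) {x y : Q ⟶ WithPoint Y}
    (e : StablyEq Z (q ≫ x) (q ≫ y)) : StablyEq Z x y := by
  have := hq.epi
  obtain ⟨B₀, B₁, i, j, hij, w, h₂, h₃⟩ := e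
  have htwo := isSum_coprod (⊤_ D) (⊤_ D)
  obtain ⟨χ, hχ₁, hχ₂⟩ := hij.exists_desc (terminal.from B₀ ≫ coprod.inl)
    (terminal.from B₁ ≫ coprod.inr : B₁ ⟶ (⊤_ D) ⨿ (⊤_ D))
  obtain ⟨χ', hχ', -⟩ := hq.2 χ (IsTrivial.of_tgt (hZ.sum _ _ htwo hZ.terminal hZ.terminal) _)
  subst hχ'
  have k₁ := IsPullback.of_hasPullback χ' (coprod.inl : ⊤_ D ⟶ (⊤_ D) ⨿ (⊤_ D))
  have k₂ := IsPullback.of_hasPullback χ' (coprod.inr : ⊤_ D ⟶ (⊤_ D) ⨿ (⊤_ D))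
  have hs := htwo.isSum_pullback k₁ k₂
  generalize pullback.fst χ' (coprod.inl : ⊤_ D ⟶ (⊤_ D) ⨿ (⊤_ D)) = i' at k₁ hs
  generalize pullback.fst χ' (coprod.inr : ⊤_ D ⟶ (⊤_ D) ⨿ (⊤_ D)) = j' at k₂ hs
  have w₁ : (i ≫ q) ≫ χ' = terminal.from B₀ ≫ coprod.inl := by rw [Category.assoc, hχ₁]
  have w₂ : (j ≫ q) ≫ χ' = terminal.from B₁ ≫ coprod.inr := by rw [Category.assoc, hχ₂]
  obtain ⟨q₀, hq₀⟩ : ∃ q₀, q₀ ≫ i' = i ≫ q := ⟨_, k₁.lift_fst _ _ w₁⟩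
  obtain ⟨q₁, hq₁⟩ : ∃ q₁, q₁ ≫ j' = j ≫ q := ⟨_, k₂.lift_fst _ _ w₂⟩
  have key : ∀ z : Q ⟶ WithPoint Y, IsTrivial Z (j ≫ q ≫ z) → IsTrivial Z (j' ≫ z) := by
    intro z hz
    obtain ⟨m, hm₁, hm₂⟩ := hs.exists_desc (undefinedHom _ Y) (j' ≫ z)
    rw [← hm₂]
    refine (hq.isTrivial_of_comp (hij.isTrivial hZ ?_ ?_)).precomp _
    · rw [← reassoc_of% hq₀, hm₁]
      exact (isTrivial_undefinedHom hZ _ _).precomp _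
    · rwa [← reassoc_of% hq₁, hm₂, reassoc_of% hq₁]
  refine ⟨_, _, i', j', hs, ?_, key x h₂, key y h₃⟩
  -- The morphism that is `x` on one summand of `Q` and `y` on the other agrees with `y` after `q`.
  obtain ⟨m, hm₁, hm₂⟩ := hs.exists_desc (i' ≫ x) (j' ≫ y)
  have hm : m = y := by
    rw [← cancel_epi q]
    refine hij.hom_ext ?_ ?_
    · rw [← w, ← reassoc_of% hq₀, hm₁, reassoc_of% hq₀]
    · rw [← reassoc_of% hq₁, hm₂, reassoc_of% hq₁]
  rw [← hm₁, hm]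

variable [HasPullbacks D]

/-- Kernels are preserved by adding a point. -/
theorem IsZKernel.withPoint (hZ : IsSummandClosed Z) {K A B : D} {k : K ⟶ A} {g : A ⟶ B}
    (hk : IsZKernel Z k g) :
    IsZKernel Z (extendHom (k ≫ toWithPoint A)) (extendHom (g ≫ toWithPoint B)) := by
  have := hk.mono
  have e₁ := toWithPoint_extendHom (k ≫ toWithPoint A)
  have e₂ := toWithPoint_extendHom (g ≫ toWithPoint B)
  have p₁ := point_extendHom (k ≫ toWithPoint A)
  have p₂ := point_extendHom (g ≫ toWithPoint B)
  have hpb := ((isSum_withPoint A).vanKampen (i' := toWithPoint K) (j' := point K) (a := k)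
    (b := 𝟙 _) (f := extendHom (k ≫ toWithPoint A)) e₁.symm (by rw [p₁, Category.id_comp])).mp
    (isSum_withPoint K)
  have hmono : Mono (extendHom (k ≫ toWithPoint A)) := by
    refine ⟨fun {T} x y w => ?_⟩
    obtain ⟨T₁, T₂, p, q, a, b, hpq, c₁, c₂⟩ := (isSum_withPoint K).cases_elem x
    refine hpq.hom_ext ?_ ?_
    · have w' : (p ≫ y) ≫ extendHom (k ≫ toWithPoint A) = (a ≫ k) ≫ toWithPoint A := by
        rw [Category.assoc, ← w, reassoc_of% c₁, e₁, Category.assoc]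
      have l₁ := hpb.1.lift_fst _ _ w'
      have l₂ := hpb.1.lift_snd _ _ w'
      rw [cancel_mono] at l₂
      rw [c₁, ← l₁, l₂]
    · have w' : (q ≫ y) ≫ extendHom (k ≫ toWithPoint A) = b ≫ point A := by
        rw [Category.assoc, ← w, reassoc_of% c₂, p₁]
      have l₁ := hpb.2.lift_fst _ _ w'
      have l₂ := hpb.2.lift_snd _ _ w'
      rw [Category.comp_id] at l₂
      rw [c₂, ← l₁, l₂]
  refine ⟨(isSum_withPoint K).isTrivial hZ ?_ ?_, fun Y l hl => ?_⟩
  · rw [reassoc_of% e₁, e₂, ← Category.assoc]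
    exact hk.1.postcomp _
  · rw [reassoc_of% p₁, p₂]
    exact isTrivial_point hZ B
  · obtain ⟨T₁, T₂, p, q, a, b, hpq, c₁, c₂⟩ := (isSum_withPoint A).cases_elem l
    obtain ⟨a', ha', -⟩ := hk.2 a (by
      rw [← isTrivial_comp_toWithPoint_iff hZ, Category.assoc, ← e₂, ← reassoc_of% c₁]
      exact hl.precomp p)
    obtain ⟨l', hl₁, hl₂⟩ := hpq.exists_desc (a' ≫ toWithPoint K) (b ≫ point K)
    have hl' : l' ≫ extendHom (k ≫ toWithPoint A) = l := by
      refine hpq.hom_ext ?_ ?_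
      · rw [reassoc_of% hl₁, e₁, reassoc_of% ha', c₁]
      · rw [reassoc_of% hl₂, p₁, c₂]
    exact ⟨l', hl', fun m hm => by rw [← cancel_mono (extendHom (k ≫ toWithPoint A)), hm, hl']⟩

end KernelsCokernels

/-! ### Generalized elements of internal relations -/

namespace IntRel

variable {C : Type u} [Category.{v} C]

/-- The pair of generalized elements `(a, b)` belongs to the relation. -/
def Mem {A : C} (ρ : IntRel A) {T : C} (a b : T ⟶ A) : Prop :=
  ∃ t : T ⟶ ρ.obj, t ≫ ρ.fst = a ∧ t ≫ ρ.snd = b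

theorem mem_self {A : C} (ρ : IntRel A) : ρ.Mem ρ.fst ρ.snd :=
  ⟨𝟙 _, Category.id_comp _, Category.id_comp _⟩

theorem Mem.precomp {A : C} {ρ : IntRel A} {T : C} {a b : T ⟶ A} (h : ρ.Mem a b) {S : C}
    (s : S ⟶ T) : ρ.Mem (s ≫ a) (s ≫ b) := by
  obtain ⟨t, rfl, rfl⟩ := h
  exact ⟨s ≫ t, Category.assoc _ _ _, Category.assoc _ _ _⟩

theorem Contained.mem {A : C} {ρ σ : IntRel A} (h : ρ.Contained σ) {T : C} {a b : T ⟶ A}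
    (hab : ρ.Mem a b) : σ.Mem a b := by
  obtain ⟨t, rfl, rfl⟩ := hab
  exact Mem.precomp h t

theorem Mem.coprod_desc [HasBinaryCoproducts C] {A : C} {ρ : IntRel A} {T T' : C} {a b : T ⟶ A}
    {a' b' : T' ⟶ A} (h : ρ.Mem a b) (h' : ρ.Mem a' b') :
    ρ.Mem (coprod.desc a a') (coprod.desc b b') := by
  obtain ⟨t, rfl, rfl⟩ := h
  obtain ⟨t', rfl, rfl⟩ := h'
  exact ⟨coprod.desc t t', by simp, by simp⟩

theorem Mem.of_coprod_desc [HasBinaryCoproducts C] {A : C} {ρ : IntRel A} {T T' : C}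
    {a b : T ⟶ A} {a' b' : T' ⟶ A} (h : ρ.Mem (coprod.desc a a') (coprod.desc b b')) :
    ρ.Mem a b ∧ ρ.Mem a' b' :=
  ⟨by simpa [coprod.inl_desc] using h.precomp coprod.inl,
    by simpa [coprod.inr_desc] using h.precomp coprod.inr⟩

theorem IsTransitive.mem_trans [HasPullbacks C] {A : C} {ρ : IntRel A} (h : ρ.IsTransitive)
    {T : C} {a b c : T ⟶ A} (h₁ : ρ.Mem a b) (h₂ : ρ.Mem b c) : ρ.Mem a c := by
  obtain ⟨x, rfl, rfl⟩ := h₁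
  obtain ⟨y, hy, rfl⟩ := h₂
  exact h.elim x y hy.symm

theorem isTransitive_of_mem_trans [HasPullbacks C] {A : C} {ρ : IntRel A}
    (h : ∀ ⦃T : C⦄ (a b c : T ⟶ A), ρ.Mem a b → ρ.Mem b c → ρ.Mem a c) : ρ.IsTransitive :=
  IsTransitive.intro fun _ x y w => h _ _ _ ⟨x, rfl, rfl⟩ ⟨y, w.symm, rfl⟩

/-- The opposite relation. -/
abbrev op {A : C} (ρ : IntRel A) : IntRel A where
  obj := ρ.obj
  fst := ρ.snd
  snd := ρ.fst
  jointly_mono := ⟨fun _ _ _ h₁ h₂ => ρ.hom_ext h₂ h₁⟩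

theorem mem_op_iff {A : C} {ρ : IntRel A} {T : C} {a b : T ⟶ A} : ρ.op.Mem a b ↔ ρ.Mem b a :=
  ⟨fun ⟨t, h₁, h₂⟩ => ⟨t, h₂, h₁⟩, fun ⟨t, h₁, h₂⟩ => ⟨t, h₂, h₁⟩⟩

theorem mono_prod_lift [HasBinaryProducts C] {A : C} (ρ : IntRel A) :
    Mono (prod.lift ρ.fst ρ.snd) :=
  ⟨fun x y w => ρ.hom_ext (by simpa [prod.lift_fst] using congrArg (· ≫ prod.fst) w)
    (by simpa [prod.lift_snd] using congrArg (· ≫ prod.snd) w)⟩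

/-- The inverse image of a relation along a morphism. -/
theorem exists_comap [HasFiniteLimits C] {A B : C} (x : A ⟶ B) (σ : IntRel B) :
    ∃ ρ : IntRel A, ∀ ⦃T : C⦄ (a b : T ⟶ A), ρ.Mem a b ↔ σ.Mem (a ≫ x) (b ≫ x) := by
  have := σ.mono_prod_lift
  have hp := IsPullback.of_hasPullback (prod.map x x) (prod.lift σ.fst σ.snd)
  have hmono : Mono (pullback.fst (prod.map x x) (prod.lift σ.fst σ.snd)) := inferInstance
  generalize pullback.fst (prod.map x x) (prod.lift σ.fst σ.snd) = p at hp hmono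
  generalize pullback.snd (prod.map x x) (prod.lift σ.fst σ.snd) = s at hp
  refine ⟨⟨_, p ≫ prod.fst, p ≫ prod.snd, ⟨fun T y z h₁ h₂ => ?_⟩⟩, fun T a b => ⟨?_, ?_⟩⟩
  · rw [← cancel_mono p]
    ext
    · simpa using h₁
    · simpa using h₂
  · rintro ⟨t, rfl, rfl⟩
    refine ⟨t ≫ s, ?_, ?_⟩
    · have := congrArg (fun k => t ≫ k ≫ prod.fst) hp.w
      simpa [prod.lift_fst] using this.symm
    · have := congrArg (fun k => t ≫ k ≫ prod.snd) hp.w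
      simpa [prod.lift_snd] using this.symm
  · rintro ⟨t, h₁, h₂⟩
    have w : prod.lift a b ≫ prod.map x x = t ≫ prod.lift σ.fst σ.snd := by
      ext
      · simpa [prod.lift_fst] using h₁.symm
      · simpa [prod.lift_snd] using h₂.symm
    have l := hp.lift_fst _ _ w
    exact ⟨hp.lift _ _ w, by rw [reassoc_of% l, prod.lift_fst],
      by rw [reassoc_of% l, prod.lift_snd]⟩

/-- The smallest relation that contains a given pair of generalized elements. -/
theorem exists_image [Regular C] {A R : C} (a b : R ⟶ A) :
    ∃ ρ : IntRel A, ρ.Mem a b ∧ ∀ σ : IntRel A, σ.Mem a b → ρ.Contained σ := by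
  let F := Regular.strongEpiMonoFactorisation (prod.lift a b)
  have hF : F.e ≫ F.m = prod.lift a b := F.fac
  have : StrongEpi F.e := F.e_strong_epi
  refine ⟨⟨F.I, F.m ≫ prod.fst, F.m ≫ prod.snd, ⟨fun T y z h₁ h₂ => ?_⟩⟩,
    ⟨F.e, by rw [reassoc_of% hF, prod.lift_fst], by rw [reassoc_of% hF, prod.lift_snd]⟩, ?_⟩
  · rw [← cancel_mono F.m]
    ext
    · simpa using h₁
    · simpa using h₂
  · rintro σ ⟨t, h₁, h₂⟩
    have := σ.mono_prod_lift
    have sq : CommSq t F.e (prod.lift σ.fst σ.snd) F.m := ⟨by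
      rw [hF]
      ext
      · simpa [prod.lift_fst] using h₁
      · simpa [prod.lift_snd] using h₂⟩
    obtain ⟨l, hl⟩ : ∃ l, l ≫ prod.lift σ.fst σ.snd = F.m := ⟨_, sq.fac_right⟩
    exact ⟨l, by simpa [prod.lift_fst] using congrArg (· ≫ prod.fst) hl,
      by simpa [prod.lift_snd] using congrArg (· ≫ prod.snd) hl⟩

/-- The smallest transitive relation that contains a given pair of generalized elements. -/
theorem exists_transitive_span [TauPretopos C] {A R : C} (a b : R ⟶ A) :
    ∃ τ : IntRel A, τ.IsTransitive ∧ τ.Mem a b ∧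
      ∀ σ : IntRel A, σ.IsTransitive → σ.Mem a b → τ.Contained σ := by
  obtain ⟨ρ, h₁, h₂⟩ := exists_image a b
  obtain ⟨τ, h₃, h₄, h₅⟩ := TauPretopos.exists_transitiveClosure ρ
  exact ⟨τ, h₄, h₃.mem h₁, fun σ hσ h => h₅ σ hσ (h₂ σ h)⟩

/-- An internal equivalence relation is the kernel pair of a regular epimorphism. -/
theorem exists_quotient [Pretopos C] {A : C} (τ : IntRel A) (hr : τ.Mem (𝟙 A) (𝟙 A))
    (hs : τ.Contained τ.op) (ht : τ.IsTransitive) :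
    ∃ (Q : C) (q : A ⟶ Q), IsRegularEpi q ∧ IsKernelPair q τ.fst τ.snd := by
  obtain ⟨r, hr₁, hr₂⟩ := hr
  obtain ⟨s, hs₁, hs₂⟩ := hs
  obtain ⟨t, ht₁, ht₂⟩ := ht
  have he : EquivalenceRelation τ.fst τ.snd :=
    { toJointlyMono₂ := τ.jointly_mono
      r := r
      reflexivity₁ := hr₁
      reflexivity₂ := hr₂
      s := s
      symmetry₁ := hs₂
      symmetry₂ := hs₁
      c := _
      isLimit := pullbackIsPullback τ.snd τ.fst
      t := t
      transitivity₁ := ht₁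
      transitivity₂ := ht₂ }
  obtain ⟨B, q, hq⟩ := Pretopos.exact _ _ he.isEquivalenceRelation
  let F := Regular.strongEpiMonoFactorisation q
  have hF : F.e ≫ F.m = q := F.fac
  rw [← hF] at hq
  exact ⟨_, F.e, inferInstance, hq.cancel_right_of_mono⟩

end IntRel

/-- Parallel morphisms in a `τ`-pretopos have a coequalizer: the quotient by the equivalence
relation that they generate. -/
theorem TauPretopos.exists_coequalizer {C : Type u} [Category.{v} C] [TauPretopos C] {A R : C}
    (a b : R ⟶ A) : ∃ (Q : C) (q : A ⟶ Q), Epi q ∧ a ≫ q = b ≫ q ∧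
      ∀ ⦃Y : C⦄ (l : A ⟶ Y), a ≫ l = b ≫ l → ∃ l' : Q ⟶ Y, q ≫ l' = l := by
  -- The swapped pair and the diagonal make the generated transitive relation an equivalence
  -- relation.
  obtain ⟨τ, ht, hm, hu⟩ := IntRel.exists_transitive_span
    (coprod.desc (coprod.desc a b) (𝟙 A)) (coprod.desc (coprod.desc b a) (𝟙 A))
  obtain ⟨⟨hab, hba⟩, hr⟩ := hm.of_coprod_desc.imp_left IntRel.Mem.of_coprod_desc
  have hs : τ.Contained τ.op := by
    refine hu _ (IntRel.isTransitive_of_mem_trans fun T x y z h₁ h₂ => ?_) ?_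
    · rw [IntRel.mem_op_iff] at h₁ h₂ ⊢
      exact ht.mem_trans h₂ h₁
    · rw [IntRel.mem_op_iff]
      exact (hba.coprod_desc hab).coprod_desc hr
  obtain ⟨Q, q, hq, hk⟩ := IntRel.exists_quotient τ hr hs ht
  refine ⟨Q, q, inferInstance, ?_, fun Y l hl => ?_⟩
  · obtain ⟨t, rfl, rfl⟩ := hab
    rw [Category.assoc, Category.assoc, hk.w]
  · -- The kernel pair of `l` is an equivalence relation that identifies `a` and `b`.
    obtain ⟨κ, hκ⟩ := IntRel.exists_comap l (IntPreord.discrete Y).rel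
    have hdiag : ∀ {T : C} {x y : T ⟶ Y}, (IntPreord.discrete Y).rel.Mem x y ↔ x = y := by
      intro T x y
      constructor
      · rintro ⟨t, rfl, rfl⟩
        rfl
      · rintro rfl
        exact ⟨x, Category.comp_id x, Category.comp_id x⟩
    replace hκ : ∀ {T : C} (x y : T ⟶ A), κ.Mem x y ↔ x ≫ l = y ≫ l :=
      fun x y => (hκ x y).trans hdiag
    have hc : τ.Contained κ := by
      refine hu κ (IntRel.isTransitive_of_mem_trans fun T x y z h₁ h₂ => ?_) ?_
      · rw [hκ] at h₁ h₂ ⊢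
        exact h₁.trans h₂
      · exact (((hκ _ _).mpr hl).coprod_desc ((hκ _ _).mpr hl.symm)).coprod_desc
          ((hκ _ _).mpr rfl)
    obtain ⟨l', hl'⟩ := IsRegularEpi.exists_of_isKernelPair q hk l
      ((hκ _ _).mp (hc.mem τ.mem_self))
    exact ⟨l', hl'⟩

/-! ### Trivial internal preorders, and kernels and cokernels relative to them -/

namespace IntPreord

variable {C : Type u} [Category.{v} C] [HasPullbacks C]

theorem mem_refl (A : IntPreord C) {T : C} (a : T ⟶ A.base) : A.rel.Mem a a := by
  simpa using IntRel.Mem.precomp (ρ := A.rel) A.refl a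

theorem exists_hom {A B : IntPreord C} (x : A.base ⟶ B.base)
    (h : B.rel.Mem (A.rel.fst ≫ x) (A.rel.snd ≫ x)) : ∃ g : A ⟶ B, g.base = x := by
  obtain ⟨t, h₁, h₂⟩ := h
  exact ⟨⟨x, t, h₁, h₂⟩, rfl⟩

theorem trivialObj_iff {A : IntPreord C} : trivialObj C A ↔ A.rel.fst = A.rel.snd := by
  constructor
  · rintro ⟨⟨s, h₁, h₂⟩, h⟩
    simpa using h (𝟙 _) s (by simp [h₂]) (by simp [h₁])
  · intro h
    exact ⟨⟨𝟙 _, by simp [h], by simp [h]⟩, fun T x y _ _ => by rw [h]⟩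

/-- A morphism is trivial exactly when it coequalizes the two projections of the relation of its
source. -/
theorem isTrivial_iff {A B : IntPreord C} {f : A ⟶ B} :
    IsTrivial (trivialObj C) f ↔ A.rel.fst ≫ f.base = A.rel.snd ≫ f.base := by
  constructor
  · rintro ⟨W, hW, g, h, rfl⟩
    rw [trivialObj_iff] at hW
    rw [comp_base, ← Category.assoc, ← Category.assoc, ← g.w_fst, ← g.w_snd, hW]
  · intro h
    obtain ⟨g, hg⟩ := exists_of_discrete (𝟙 B.base) (B := B)
    obtain ⟨k, hk⟩ := exists_hom (A := A) (B := discrete B.base) f.base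
      ⟨A.rel.fst ≫ f.base, Category.comp_id _, (Category.comp_id _).trans h⟩
    exact ⟨discrete B.base, trivialObj_iff.mpr rfl, k, g,
      hom_ext (by rw [comp_base, hk, hg]; exact Category.comp_id _)⟩

theorem isSummandClosed_trivialObj [FinitaryExtensive C] [HasTerminal C] :
    IsSummandClosed (trivialObj C) where
  sum X Y S i j h hX hY := by
    rw [trivialObj_iff] at *
    obtain ⟨-, hr⟩ := isSum_iff.mp h
    exact hr.hom_ext (by rw [i.w_fst, i.w_snd, hX]) (by rw [j.w_fst, j.w_snd, hY])
  summand X Y S i j h hS := by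
    rw [trivialObj_iff] at *
    obtain ⟨hb, -⟩ := isSum_iff.mp h
    have := hb.mono_left
    rw [← cancel_mono i.base, ← i.w_fst, ← i.w_snd, hS]
  terminal := by
    have h : IsTrivial (trivialObj C) (𝟙 (⊤_ (IntPreord C))) :=
      ⟨discrete (⊤_ C), trivialObj_iff.mpr rfl, Hom.mk (terminal.from _) (terminal.from _)
        (terminalIsTerminal.hom_ext _ _) (terminalIsTerminal.hom_ext _ _), terminal.from _,
        terminalIsTerminal.hom_ext _ _⟩
    rw [isTrivial_iff, id_base, Category.comp_id, Category.comp_id] at h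
    exact trivialObj_iff.mpr h

/-- The kernel of `g : (A, ρ) ⟶ (B, σ)` is `A` with the intersection of `ρ` and the kernel pair
of `g`. -/
theorem exists_zKernel [HasEqualizers C] {A B : IntPreord C} (g : A ⟶ B) :
    ∃ (K : IntPreord C) (k : K ⟶ A), IsZKernel (trivialObj C) k g := by
  let ι := equalizer.ι (A.rel.fst ≫ g.base) (A.rel.snd ≫ g.base)
  have hι : ι ≫ A.rel.fst ≫ g.base = ι ≫ A.rel.snd ≫ g.base := equalizer.condition _ _
  let ρ : IntRel A.base := ⟨_, ι ≫ A.rel.fst, ι ≫ A.rel.snd, ⟨fun T x y h₁ h₂ => by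
    rw [← cancel_mono ι]
    exact A.rel.hom_ext (by simpa using h₁) (by simpa using h₂)⟩⟩
  have hρ : ∀ ⦃T : C⦄ (a b : T ⟶ A.base),
      ρ.Mem a b ↔ A.rel.Mem a b ∧ a ≫ g.base = b ≫ g.base := by
    intro T a b
    constructor
    · rintro ⟨t, rfl, rfl⟩
      exact ⟨⟨t ≫ ι, by simp [ρ], by simp [ρ]⟩, by simp [ρ, hι]⟩
    · rintro ⟨⟨t, rfl, rfl⟩, h⟩
      exact ⟨equalizer.lift t (by simpa using h), by simp [ρ, ι], by simp [ρ, ι]⟩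
  let K : IntPreord C := ⟨A.base, ρ, (hρ _ _).mpr ⟨A.refl, rfl⟩,
    IntRel.isTransitive_of_mem_trans fun T a b c h₁ h₂ => by
      rw [hρ] at *
      exact ⟨A.trans.mem_trans h₁.1 h₂.1, h₁.2.trans h₂.2⟩⟩
  obtain ⟨hK, hK'⟩ := (hρ _ _).mp ρ.mem_self
  obtain ⟨k, hk⟩ := exists_hom (A := K) (B := A) (𝟙 A.base) (by
    change A.rel.Mem (ρ.fst ≫ 𝟙 A.base) (ρ.snd ≫ 𝟙 A.base)
    rwa [Category.comp_id, Category.comp_id])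
  refine ⟨K, k, isTrivial_iff.mpr ?_, fun Y l hl => ?_⟩
  · rw [comp_base, hk, Category.id_comp]
    exact hK'
  · rw [isTrivial_iff] at hl
    obtain ⟨l', hl'⟩ := exists_hom (A := Y) (B := K) l.base
      ((hρ _ _).mpr ⟨⟨l.rel, l.w_fst, l.w_snd⟩, by simpa using hl⟩)
    refine ⟨l', hom_ext (by rw [comp_base, hk, hl']; exact Category.comp_id _), fun m hm => ?_⟩
    refine hom_ext ?_
    rw [hl', ← hm, comp_base, hk]
    exact (Category.comp_id _).symm

/-- The cokernel of `f : (A, ρ) ⟶ (B, σ)` is the coequalizer of `ρ` in `B`, with the preorder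
generated by the image of `σ`. -/
theorem exists_zCokernel {C : Type u} [Category.{v} C] [TauPretopos C] {A B : IntPreord C}
    (f : A ⟶ B) : ∃ (Q : IntPreord C) (q : B ⟶ Q), IsZCokernel (trivialObj C) f q := by
  obtain ⟨Q, q, hepi, hq, hu⟩ := TauPretopos.exists_coequalizer
    (A.rel.fst ≫ f.base) (A.rel.snd ≫ f.base)
  -- The diagonal makes the generated transitive relation reflexive.
  obtain ⟨τ, ht, hm, hτ⟩ := IntRel.exists_transitive_span
    (coprod.desc (B.rel.fst ≫ q) (𝟙 Q)) (coprod.desc (B.rel.snd ≫ q) (𝟙 Q))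
  obtain ⟨hB, hr⟩ := hm.of_coprod_desc
  obtain ⟨q', hq'⟩ := exists_hom (A := B) (B := ⟨Q, τ, hr, ht⟩) q hB
  refine ⟨_, q', isTrivial_iff.mpr ?_, fun Y l hl => ?_⟩
  · rw [comp_base, hq', ← Category.assoc, hq, Category.assoc]
  · rw [isTrivial_iff, comp_base, ← Category.assoc, ← Category.assoc] at hl
    obtain ⟨m, hm⟩ := hu l.base hl
    obtain ⟨υ, hυ⟩ := IntRel.exists_comap m Y.rel
    have hc : τ.Contained υ := by
      refine hτ υ (IntRel.isTransitive_of_mem_trans fun T a b c h₁ h₂ => ?_)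
        (IntRel.Mem.coprod_desc ?_ ?_)
      · rw [hυ] at *
        exact Y.trans.mem_trans h₁ h₂
      · rw [hυ, Category.assoc, Category.assoc, hm]
        exact ⟨l.rel, l.w_fst, l.w_snd⟩
      · rw [hυ]
        exact Y.mem_refl _
    obtain ⟨m', hm'⟩ := exists_hom (A := ⟨Q, τ, hr, ht⟩) (B := Y) m
      ((hυ _ _).mp (hc.mem τ.mem_self))
    refine ⟨m', hom_ext (by rw [comp_base, hq', hm', hm]), fun n hn => hom_ext ?_⟩
    have : q ≫ n.base = q ≫ m := by rw [hm, ← hn, comp_base, hq']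
    rw [hm']
    exact (cancel_epi q).mp this

end IntPreord

open IntPreord

/-! ### Partial morphisms of internal preorders as total morphisms -/

section StableCategory

variable {C : Type u} [Category.{v} C] [HasPullbacks C] [FinitaryExtensive C]

theorem Stab.exists_toStab_obj (Y : Stab C) : ∃ A : IntPreord C, (toStab C).obj A = Y :=
  ⟨Y.as.obj, rfl⟩

variable [HasTerminal C]

namespace PartialSpan

variable {A B E : IntPreord C}

theorem exists_total (s : PartialSpan A B) :
    ∃ h : A ⟶ WithPoint B, IsPullback s.incl s.map h (toWithPoint B) := by
  obtain ⟨_, c, hc⟩ := s.complemented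
  exact exists_isPullback ((isComplement_iff_isSum _ _).mp hc) s.map

/-- The morphism `A ⟶ B + 1` that corresponds to a partial morphism: it is constant at the added
point outside the domain of definition. -/
noncomputable def total (s : PartialSpan A B) : A ⟶ WithPoint B := s.exists_total.choose

theorem isPullback_total (s : PartialSpan A B) :
    IsPullback s.incl s.map s.total (toWithPoint B) := s.exists_total.choose_spec

theorem total_congr {s t : PartialSpan A B} (h : Rel s t) : s.total = t.total := by
  obtain ⟨e, h₁, h₂⟩ := h
  refine eq_of_isPullback s.isPullback_total (IsPullback.of_iso t.isPullback_total e.symm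
    (Iso.refl _) (Iso.refl _) (Iso.refl _) ?_ ?_ (by simp) (by simp))
  · simp [← h₁]
  · simp [← h₂]

theorem rel_of_total_eq {s t : PartialSpan A B} (h : s.total = t.total) : Rel s t := by
  have hs := s.isPullback_total
  rw [h] at hs
  exact ⟨hs.isoIsPullback _ _ t.isPullback_total, IsPullback.isoIsPullback_hom_fst _ _ _ _,
    IsPullback.isoIsPullback_hom_snd _ _ _ _⟩

theorem total_comp (s : PartialSpan A B) (t : PartialSpan B E) :
    (s.comp t).total = s.total ≫ extendHom t.total :=
  eq_of_isPullback (s.comp t).isPullback_total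
    (isPullback_comp s.isPullback_total t.isPullback_total (isPullback_pb s.map t.incl))

theorem total_ofHom (f : A ⟶ B) : (ofHom f).total = f ≫ toWithPoint B :=
  eq_of_isPullback (ofHom f).isPullback_total (isPullback_id f)

theorem exists_total_eq (h : A ⟶ WithPoint B) : ∃ s : PartialSpan A B, s.total = h := by
  have hp := IsPullback.of_hasPullback h (toWithPoint B)
  obtain ⟨_, c, hc, -⟩ := exists_isSum_of_isPullback hp
  let s : PartialSpan A B := ⟨_, _, ⟨_, c, (isComplement_iff_isSum _ _).mpr hc⟩,
    pullback.snd h (toWithPoint B)⟩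
  exact ⟨s, eq_of_isPullback s.isPullback_total hp⟩

theorem congruenceDiagram_iff (s t : PartialSpan A B) :
    CongruenceDiagram s t ↔ StablyEq (trivialObj C) s.total t.total := by
  have hZ := isSummandClosed_trivialObj (C := C)
  constructor
  · rintro ⟨A₀, A₁, A₂, i₁, i₂, c₁, c₂, h₁, h₂, hα, ⟨_, c, hc⟩, hf, ht₁, ht₂⟩
    rw [isComplement_iff_isSum] at h₁ h₂ hc
    exact stablyEq_of_congruence hZ s.isPullback_total t.isPullback_total h₁ h₂ hα hc hf ht₁ ht₂
  · intro e
    obtain ⟨A₀, A₁, A₂, i₁, i₂, c₁, c₂, h₁, h₂, hα, hf, ht₁, ht₂⟩ :=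
      e.exists_congruence hZ s.isPullback_total t.isPullback_total
    rw [← isComplement_iff_isSum] at h₁ h₂
    exact ⟨A₀, A₁, A₂, i₁, i₂, c₁, c₂, h₁, h₂, hα, isComplemented_comp ⟨_, _, h₁⟩ s.complemented,
      hf, ht₁, ht₂⟩

end PartialSpan

namespace PaPreord

variable {A B E : PaPreord C}

/-- The morphism `A ⟶ B + 1` that corresponds to a morphism of the category of partial
morphisms. -/
noncomputable def total (F : A ⟶ B) : A.obj ⟶ WithPoint B.obj :=
  _root_.Quotient.lift PartialSpan.total (fun _ _ h => PartialSpan.total_congr h) F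

theorem total_injective {F G : A ⟶ B} (h : total F = total G) : F = G := by
  obtain ⟨s, rfl⟩ := _root_.Quotient.exists_rep F
  obtain ⟨t, rfl⟩ := _root_.Quotient.exists_rep G
  exact _root_.Quotient.sound (PartialSpan.rel_of_total_eq h)

theorem exists_total_eq (h : A.obj ⟶ WithPoint B.obj) : ∃ F : A ⟶ B, total F = h := by
  obtain ⟨s, hs⟩ := PartialSpan.exists_total_eq h
  exact ⟨mkHom s, hs⟩

/-- The morphism of the category of partial morphisms that corresponds to `h : A ⟶ B + 1`. -/
noncomputable def ofTotal (h : A.obj ⟶ WithPoint B.obj) : A ⟶ B := (exists_total_eq h).choose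

theorem total_ofTotal (h : A.obj ⟶ WithPoint B.obj) : total (ofTotal h : A ⟶ B) = h :=
  (exists_total_eq h).choose_spec

theorem total_comp (F : A ⟶ B) (G : B ⟶ E) : total (F ≫ G) = total F ≫ extendHom (total G) := by
  obtain ⟨s, rfl⟩ := _root_.Quotient.exists_rep F
  obtain ⟨t, rfl⟩ := _root_.Quotient.exists_rep G
  exact PartialSpan.total_comp s t

theorem total_incl {A B : IntPreord C} (f : A ⟶ B) :
    total ((incl C).map f) = f ≫ toWithPoint B := PartialSpan.total_ofHom f

theorem total_id (A : PaPreord C) : total (𝟙 A) = toWithPoint A.obj :=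
  (PartialSpan.total_ofHom _).trans (Category.id_comp _)

theorem stableRel_iff (F G : A ⟶ B) :
    stableRel C F G ↔ StablyEq (trivialObj C) (total F) (total G) := by
  constructor
  · rintro ⟨s, t, rfl, rfl, h⟩
    exact (PartialSpan.congruenceDiagram_iff s t).mp h
  · intro h
    obtain ⟨s, rfl⟩ := _root_.Quotient.exists_rep F
    obtain ⟨t, rfl⟩ := _root_.Quotient.exists_rep G
    exact ⟨s, t, rfl, rfl, (PartialSpan.congruenceDiagram_iff s t).mpr h⟩

instance : Congruence (stableRel C) where
  comp_left F G G' h := by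
    rw [stableRel_iff] at h ⊢
    rw [total_comp, total_comp]
    exact (h.extend isSummandClosed_trivialObj).precomp _
  comp_right G h := by
    rw [stableRel_iff] at h ⊢
    rw [total_comp, total_comp]
    exact h.postcomp _
  equivalence :=
    { refl := fun F => (stableRel_iff F F).mpr (StablyEq.refl isSummandClosed_trivialObj _)
      symm := fun h => (stableRel_iff _ _).mpr ((stableRel_iff _ _).mp h).symm
      trans := fun h h' => (stableRel_iff _ _).mpr (((stableRel_iff _ _).mp h).trans
        isSummandClosed_trivialObj ((stableRel_iff _ _).mp h')) }

end PaPreord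

/-! ### The stable category -/

namespace Stab

variable {A B E : IntPreord C}

/-- The stable morphism represented by a total morphism `A ⟶ B + 1`. -/
noncomputable def mk (h : A ⟶ WithPoint B) : (toStab C).obj A ⟶ (toStab C).obj B :=
  (CategoryTheory.Quotient.functor (stableRel C)).map
    (PaPreord.ofTotal (A := ⟨A⟩) (B := ⟨B⟩) h)

theorem map_eq_mk (F : (PaPreord.mk A : PaPreord C) ⟶ PaPreord.mk B) :
    (CategoryTheory.Quotient.functor (stableRel C)).map F = mk (PaPreord.total F) := by
  exact congrArg _ (PaPreord.total_injective (PaPreord.total_ofTotal _).symm)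

theorem exists_mk_eq (F : (toStab C).obj A ⟶ (toStab C).obj B) :
    ∃ h : A ⟶ WithPoint B, mk h = F := by
  obtain ⟨F', rfl⟩ := (CategoryTheory.Quotient.functor (stableRel C)).map_surjective F
  exact ⟨_, (map_eq_mk F').symm⟩

theorem mk_eq_iff {h h' : A ⟶ WithPoint B} :
    mk h = mk h' ↔ StablyEq (trivialObj C) h h' :=
  (CategoryTheory.Quotient.functor_map_eq_iff _ (PaPreord.ofTotal (A := ⟨A⟩) (B := ⟨B⟩) h)
    (PaPreord.ofTotal h')).trans ((PaPreord.stableRel_iff _ _).trans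
      (by rw [PaPreord.total_ofTotal, PaPreord.total_ofTotal]))

theorem mk_comp (g : A ⟶ WithPoint B) (h : B ⟶ WithPoint E) :
    mk g ≫ mk h = mk (g ≫ extendHom h) := by
  obtain ⟨F, rfl⟩ := PaPreord.exists_total_eq (A := ⟨A⟩) (B := ⟨B⟩) g
  obtain ⟨G, rfl⟩ := PaPreord.exists_total_eq (A := ⟨B⟩) (B := ⟨E⟩) h
  rw [← PaPreord.total_comp, ← map_eq_mk, ← map_eq_mk, ← map_eq_mk]
  exact (Functor.map_comp _ F G).symm

theorem toStab_map (f : A ⟶ B) : (toStab C).map f = mk (f ≫ toWithPoint B) :=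
  (map_eq_mk _).trans (congrArg mk (PaPreord.total_incl f))

theorem toStab_map_comp_mk (f : A ⟶ B) (h : B ⟶ WithPoint E) :
    (toStab C).map f ≫ mk h = mk (f ≫ h) := by
  rw [toStab_map, mk_comp, Category.assoc, toWithPoint_extendHom]

/-- Every stable morphism is total up to the isomorphism `B ≅ B + 1`. -/
theorem mk_comp_toStab_map (h : A ⟶ WithPoint B) :
    mk h ≫ (toStab C).map (toWithPoint B) = (toStab C).map h := by
  rw [toStab_map, toStab_map, mk_comp, mk_eq_iff]
  exact stablyEq_comp_toWithPoint isSummandClosed_trivialObj h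

instance isIso_toStab_map (B : IntPreord C) : IsIso ((toStab C).map (toWithPoint B)) := by
  refine ⟨mk (𝟙 _), ?_, ?_⟩
  · rw [toStab_map_comp_mk, Category.comp_id, ← (toStab C).map_id, toStab_map, Category.id_comp]
  · rw [mk_comp_toStab_map, (toStab C).map_id]

theorem isZero_toStab_obj (hA : trivialObj C A) : IsZero ((toStab C).obj A) := by
  have hZ := isSummandClosed_trivialObj (C := C)
  refine ⟨?_, ?_⟩
  · intro Y
    obtain ⟨Y, rfl⟩ := exists_toStab_obj Y
    refine ⟨⟨⟨mk (undefinedHom A Y)⟩, fun F => ?_⟩⟩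
    obtain ⟨h, rfl⟩ := exists_mk_eq F
    exact mk_eq_iff.mpr (StablyEq.of_isTrivial ⟨A, hA, 𝟙 A, h, Category.id_comp _⟩
      (isTrivial_undefinedHom hZ A Y))
  · intro Y
    obtain ⟨Y, rfl⟩ := exists_toStab_obj Y
    refine ⟨⟨⟨mk (undefinedHom Y A)⟩, fun F => ?_⟩⟩
    obtain ⟨h, rfl⟩ := exists_mk_eq F
    exact mk_eq_iff.mpr (StablyEq.of_isTrivial
      (IsTrivial.of_tgt (hZ.sum _ _ (isSum_withPoint A) hA hZ.terminal) h)
      (isTrivial_undefinedHom hZ Y A))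

/-- In the stable category a morphism factors through a zero object exactly when its
representatives are trivial. -/
theorem isTrivial_mk_iff {h : A ⟶ WithPoint B} :
    IsTrivial (zeroObjects (Stab C)) (mk h) ↔ IsTrivial (trivialObj C) h := by
  have hZ := isSummandClosed_trivialObj (C := C)
  constructor
  · rintro ⟨W, hW, F, G, w⟩
    obtain ⟨W, rfl⟩ := exists_toStab_obj W
    obtain ⟨a, rfl⟩ := exists_mk_eq F
    obtain ⟨b, rfl⟩ := exists_mk_eq G
    -- A morphism out of a zero object is equal to the nowhere defined one.
    have hb : mk b = mk (undefinedHom W B) := hW.eq_of_src _ _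
    rw [hb, mk_comp, mk_eq_iff] at w
    refine w.isTrivial hZ (IsTrivial.precomp ?_ _)
    exact isTrivial_extendHom hZ (isTrivial_undefinedHom hZ W B)
  · rintro ⟨W, hW, a, b, rfl⟩
    exact ⟨_, isZero_toStab_obj hW, (toStab C).map a, mk b, toStab_map_comp_mk a b⟩

theorem isTrivial_toStab_map_iff {f : A ⟶ B} :
    IsTrivial (zeroObjects (Stab C)) ((toStab C).map f) ↔ IsTrivial (trivialObj C) f := by
  rw [toStab_map, isTrivial_mk_iff, isTrivial_comp_toWithPoint_iff isSummandClosed_trivialObj]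

/-- The functor to the stable category preserves cokernels. Existence of factorizations is that for
morphisms into `Y + 1`; uniqueness is `IsZCokernel.stablyEq_of_comp`. -/
theorem isCoker_toStab_map {Q : IntPreord C} {f : A ⟶ B} {q : B ⟶ Q}
    (hq : IsZCokernel (trivialObj C) f q) :
    IsCoker ((toStab C).map f) ((toStab C).map q) := by
  refine ⟨?_, ?_⟩
  · rw [← Functor.map_comp, isTrivial_toStab_map_iff]
    exact hq.1
  · intro Y l hl
    obtain ⟨Y, rfl⟩ := exists_toStab_obj Y
    obtain ⟨h, rfl⟩ := exists_mk_eq l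
    rw [toStab_map_comp_mk, isTrivial_mk_iff] at hl
    obtain ⟨h', rfl, -⟩ := hq.2 h hl
    refine ⟨mk h', toStab_map_comp_mk q h', fun m hm => ?_⟩
    obtain ⟨x, rfl⟩ := exists_mk_eq m
    rw [toStab_map_comp_mk, mk_eq_iff] at hm
    exact mk_eq_iff.mpr (hq.stablyEq_of_comp isSummandClosed_trivialObj hm)

/-- The functor to the stable category preserves kernels. A partial morphism into `A` corresponds
to a morphism into `A + 1`, and the kernel of `g` remains a kernel after a point is added. -/
theorem isKer_toStab_map {K : IntPreord C} {k : K ⟶ A} {g : A ⟶ B}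
    (hk : IsZKernel (trivialObj C) k g) :
    IsKer ((toStab C).map k) ((toStab C).map g) := by
  have hk' := hk.withPoint isSummandClosed_trivialObj
  refine ⟨?_, ?_⟩
  · rw [← Functor.map_comp, isTrivial_toStab_map_iff]
    exact hk.1
  · intro Y l hl
    obtain ⟨Y, rfl⟩ := exists_toStab_obj Y
    obtain ⟨h, rfl⟩ := exists_mk_eq l
    rw [toStab_map, mk_comp, isTrivial_mk_iff] at hl
    obtain ⟨h', rfl, -⟩ := hk'.2 h hl
    rw [toStab_map]
    refine ⟨mk h', mk_comp _ _, fun m hm => ?_⟩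
    obtain ⟨x, rfl⟩ := exists_mk_eq m
    rw [mk_comp, mk_eq_iff] at hm
    exact mk_eq_iff.mpr (hk'.stablyEq_of_comp hm)

end Stab

end StableCategory

/-! ### Functors out of the stable category -/

section Induced

variable {C : Type u} [Category.{v} C] [HasPullbacks C] [FinitaryExtensive C] [HasTerminal C]
  {X : Type u'} [Category.{v'} X]

/-- A functor that inverts the inclusions `B ⟶ B + 1` and identifies stably equal morphisms
factors through the stable category: `h : A ⟶ B + 1` is sent to `G h ≫ (G B ⟶ G (B + 1))⁻¹`. -/
theorem Stab.exists_lift (G : IntPreord C ⥤ X) (hI : ∀ B, IsIso (G.map (toWithPoint B)))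
    (hE : ∀ ⦃A B : IntPreord C⦄ (h h' : A ⟶ B), StablyEq (trivialObj C) h h' →
      G.map h = G.map h') : ∃ Gbar : Stab C ⥤ X, toStab C ⋙ Gbar = G := by
  let P : PaPreord C ⥤ X :=
    { obj := fun A => G.obj A.obj
      map := fun {A B} F => G.map (PaPreord.total F) ≫ inv (G.map (toWithPoint B.obj))
      map_id := fun A => by rw [PaPreord.total_id, IsIso.hom_inv_id]
      map_comp := fun {A B E} F F' => by
        have e : inv (G.map (toWithPoint B.obj)) ≫ G.map (PaPreord.total F') =
            G.map (extendHom (PaPreord.total F')) := by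
          rw [IsIso.inv_comp_eq, ← G.map_comp, toWithPoint_extendHom]
        rw [PaPreord.total_comp, G.map_comp, Category.assoc, Category.assoc, reassoc_of% e] }
  have hP : ∀ (A B : PaPreord C) (F F' : A ⟶ B), stableRel C F F' → P.map F = P.map F' := by
    intro A B F F' h
    exact congrArg (· ≫ inv (G.map (toWithPoint B.obj)))
      (hE _ _ ((PaPreord.stableRel_iff F F').mp h))
  refine ⟨CategoryTheory.Quotient.lift _ P hP, ?_⟩
  refine CategoryTheory.Functor.hext (fun A => rfl) (fun A B f => heq_of_eq ?_)
  refine (congrArg (fun k : A ⟶ WithPoint B => G.map k ≫ inv (G.map (toWithPoint B)))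
    (PaPreord.total_incl f)).trans ?_
  rw [G.map_comp, Category.assoc, IsIso.hom_inv_id, Category.comp_id]

/-- A functor on the stable category is determined by its values on the images of morphisms of
internal preorders, since every stable morphism is such an image up to an isomorphism
`B ≅ B + 1`. -/
theorem Stab.functor_ext {H H' : Stab C ⥤ X} (h : toStab C ⋙ H = toStab C ⋙ H') : H = H' := by
  have hobj : ∀ A, H.obj ((toStab C).obj A) = H'.obj ((toStab C).obj A) := fun A =>
    Functor.congr_obj h A
  have hmap : ∀ {A B : IntPreord C} (f : A ⟶ B), H.map ((toStab C).map f) =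
      eqToHom (hobj A) ≫ H'.map ((toStab C).map f) ≫ eqToHom (hobj B).symm := fun f =>
    Functor.congr_hom h f
  refine CategoryTheory.Functor.ext (fun A => hobj A.as.obj) (fun A B F => ?_)
  obtain ⟨A, rfl⟩ := Stab.exists_toStab_obj A
  obtain ⟨B, rfl⟩ := Stab.exists_toStab_obj B
  obtain ⟨k, rfl⟩ := Stab.exists_mk_eq F
  change H.map (Stab.mk k) = eqToHom (hobj A) ≫ H'.map (Stab.mk k) ≫ eqToHom (hobj B).symm
  rw [← cancel_mono (H.map ((toStab C).map (toWithPoint B))), ← H.map_comp,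
    Stab.mk_comp_toStab_map, hmap, hmap, ← Stab.mk_comp_toStab_map, H'.map_comp]
  simp

/-- Up to isomorphism, every morphism of the stable category with its cokernel is the image of a
morphism of internal preorders with its cokernel: `f` is represented by some `h : A ⟶ B + 1`, and
`f` is the image of `h` up to the isomorphism `B ≅ B + 1`. -/
theorem Stab.exists_iso_coker {C : Type u} [Category.{v} C] [TauPretopos C] {A B Q : Stab C}
    {f : A ⟶ B} {q : B ⟶ Q} (hq : IsCoker f q) :
    ∃ (A' B' Q' : IntPreord C) (f' : A' ⟶ B') (q' : B' ⟶ Q') (c : (toStab C).obj A' ≅ A)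
      (e : (toStab C).obj B' ≅ B) (d : (toStab C).obj Q' ≅ Q), IsZCokernel (trivialObj C) f' q' ∧
      (toStab C).map f' ≫ e.hom = c.hom ≫ f ∧ e.hom ≫ q = (toStab C).map q' ≫ d.hom := by
  obtain ⟨A, rfl⟩ := Stab.exists_toStab_obj A
  obtain ⟨B, rfl⟩ := Stab.exists_toStab_obj B
  obtain ⟨h, rfl⟩ := Stab.exists_mk_eq f
  obtain ⟨Q', q', hq'⟩ := exists_zCokernel h
  let e := (asIso ((toStab C).map (toWithPoint B))).symm
  have he : (toStab C).map h ≫ e.hom = Stab.mk h := by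
    rw [← Stab.mk_comp_toStab_map, Category.assoc]
    simp [e]
  have hcoker := (Stab.isCoker_toStab_map hq').comp_iso (Iso.refl _) e (Iso.refl _)
    (f' := Stab.mk h) (q' := e.inv ≫ (toStab C).map q') (by simp [he]) (by simp)
  obtain ⟨d, hd⟩ := hcoker.exists_iso hq
  exact ⟨A, WithPoint B, Q', h, q', Iso.refl _, e, d, hq', by simp [he], by simp [← hd]⟩

end Induced

end PreordStab

open PreordStab

theorem mainTheorem10 (C : Type u) [Category.{v} C] [PreordStab.TauPretopos C]
    (X : Type u') [Category.{v'} X] [HasZeroObject X] [HasFiniteCoproducts X]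
    (T F : ObjectProperty X) (hTF : PreordStab.IsTorsionTheory T F)
    (G : PreordStab.IntPreord C ⥤ X) [PreservesFiniteCoproducts G]
    (hG : PreordStab.IsTorsionTheoryFunctor (PreordStab.IntPreord.eqRel C)
      (PreordStab.IntPreord.parOrd C) T F G) :
    ∃ Gbar : PreordStab.Stab C ⥤ X,
      PreordStab.toStab C ⋙ Gbar = G ∧
      (∀ H : PreordStab.Stab C ⥤ X, PreordStab.toStab C ⋙ H = G → H = Gbar) ∧
      ((∀ ⦃A B Q : PreordStab.IntPreord C⦄ (f : A ⟶ B) (q : B ⟶ Q),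
          PreordStab.IsZCokernel (PreordStab.IntPreord.trivialObj C) f q →
            PreordStab.IsCoker (G.map f) (G.map q)) →
        ∀ ⦃A B Q : PreordStab.Stab C⦄ (f : A ⟶ B) (q : B ⟶ Q),
          PreordStab.IsCoker f q → PreordStab.IsCoker (Gbar.map f) (Gbar.map q)) ∧
      ((∀ ⦃A B Q : PreordStab.IntPreord C⦄ (f : A ⟶ B) (g : B ⟶ Q),
          PreordStab.IsShortZExact (PreordStab.IntPreord.trivialObj C) f g →
            PreordStab.IsShortExact (G.map f) (G.map g)) →
        ∀ ⦃A B Q : PreordStab.Stab C⦄ (f : A ⟶ B) (g : B ⟶ Q),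
          PreordStab.IsShortExact f g →
            PreordStab.IsShortExact (Gbar.map f) (Gbar.map g)) := by
  have hZ := IntPreord.isSummandClosed_trivialObj (C := C)
  have hzero : ∀ W, IntPreord.trivialObj C W → IsZero (G.obj W) := by
    intro W hW
    have : (T ⊓ F) (G.obj W) := ⟨hG.map_torsion hW.1, hG.map_torsionFree hW.2⟩
    rwa [hTF.trivial_eq_zero] at this
  -- Trivial morphisms are sent to zero morphisms.
  have hG₀ : ∀ ⦃A B : IntPreord C⦄ (h h' : A ⟶ B), IsTrivial (IntPreord.trivialObj C) h →
      IsTrivial (IntPreord.trivialObj C) h' → G.map h = G.map h' := by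
    rintro A B _ _ ⟨W, hW, a, b, rfl⟩ ⟨W', hW', a', b', rfl⟩
    have : G.map b' = (hzero W' hW').to_ (G.obj W) ≫ G.map b := (hzero W' hW').eq_of_src _ _
    rw [G.map_comp, G.map_comp, this, ← Category.assoc]
    congr 1
    exact (hzero W hW).eq_of_tgt _ _
  obtain ⟨Gbar, rfl⟩ := Stab.exists_lift G
    (fun B => ((isSum_withPoint B).map G).isIso_of_isZero (hzero _ hZ.terminal))
    (by
      rintro A B h h' ⟨A₀, A₁, i, j, hij, w, h₁, h₂⟩
      refine (hij.map G).hom_ext ?_ ?_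
      · rw [← G.map_comp, ← G.map_comp, w]
      · rw [← G.map_comp, ← G.map_comp]
        exact hG₀ _ _ h₁ h₂)
  refine ⟨Gbar, rfl, fun H h => Stab.functor_ext h, fun hcoker A B Q f q hq => ?_,
    fun hexact A B Q f g hfg => ?_⟩
  · obtain ⟨A', B', Q', f', q', c, e, d, hq', w₁, w₂⟩ := Stab.exists_iso_coker hq
    exact (hcoker f' q' hq').comp_iso (Gbar.mapIso c) (Gbar.mapIso e) (Gbar.mapIso d)
      (by simpa using congrArg Gbar.map w₁) (by simpa using congrArg Gbar.map w₂)
  · obtain ⟨A', B', Q', f', q', c, e, d, hq', w₁, w₂⟩ := Stab.exists_iso_coker hfg.2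
    -- Both `f` and the image of the kernel `k` of `q'` are kernels of `g`, up to isomorphism.
    obtain ⟨K, k, hk⟩ := IntPreord.exists_zKernel q'
    have hker := (Stab.isKer_toStab_map hk).comp_iso (Iso.refl _) e d
      (k' := (toStab C).map k ≫ e.hom) (f' := g) (by simp) w₂
    obtain ⟨b, hb⟩ := hker.exists_iso hfg.1
    have h := hexact k q' (hq'.isShortZExact hk)
    have w₃ : Gbar.map ((toStab C).map k) ≫ Gbar.map e.hom = Gbar.map b.hom ≫ Gbar.map f := by
      rw [← Gbar.map_comp, ← Gbar.map_comp, hb]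
    have w₄ : Gbar.map e.hom ≫ Gbar.map g = Gbar.map ((toStab C).map q') ≫ Gbar.map d.hom := by
      rw [← Gbar.map_comp, ← Gbar.map_comp, w₂]
    exact ⟨h.1.comp_iso (Gbar.mapIso b) (Gbar.mapIso e) (Gbar.mapIso d) w₃ w₄,
      h.2.comp_iso (Gbar.mapIso b) (Gbar.mapIso e) (Gbar.mapIso d) w₃ w₄⟩
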